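/- Let $(M,g)$ be a closed smooth Riemannian manifold on which a finite group $G$ acts freely by isometries, let $H_1,H_2\le G$ be subgroups, and consider the Riemannian coverings $\pi:(M,g)\to(M_0,g_0)$ with $M_0=G\backslash M$, $g=\pi^*g_0$, and $\pi_i:(M,g)\to(M_i,g_i)$ with $M_i=H_i\backslash M$, $p_i:M_i\to M_0$, $g_i=p_i^*g_0$, $p_i\circ\pi_i=\pi$ $(i=1,2)$. Assume $(\dagger)$ $L^2(G/H_1)\simeq L^2(G/H_2)$ as unitarily equivalent $G$-modules. Notation. $G^t_{g_i}$ is the Hamiltonian flow of $H(x,\xi)=\tfrac12|\xi|_{g_i}^2$ on the unit cosphere bundle $S^*M_i$, $\mu_{L_i}$ is the normalized Liouville measure on $S^*M_i$, and $V^t_{g_i}f=f\circ G^t_{g_i}$ is the Koopman operator. $\widetilde\pi_i:S^*M\to S^*M_i$ is the lift $(x,\xi)\mapsto(\pi_i x,\ \xi\circ(d\pi_i)_x^{-1})$, $\widetilde\pi_i^*$ is pull-back of functions and $\widetilde\pi_{i*}$ is summation over the fibres of $\widetilde\pi_i$; $(\widetilde T_aF)(\zeta)=F(a^{-1}\cdot\zeta)$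 for functions $F$ on $S^*M$, where $a\in G$ acts by $a\cdot(x,\xi)=(ax,(a^{-1})^*\xi)$. Then there is a function $A$ on $H_2\backslash G/H_1$ (that is, $A:G\to\mathbb C$ with $A(b_2ab_1)=A(a)$ for $b_i\in H_i$) such that $(\mathcal A\varphi)(xH_2)=\sum_{a\in G}A(a)\,\varphi(xaH_1)$ defines a unitary $G$-equivariant operator $\mathcal A:L^2(G/H_1)\to L^2(G/H_2)$. For every such $A$: (1) $\displaystyle \widetilde U_A=\frac1{\#H_1}\sum_{a\in G}A(a)\,\widetilde\pi_{2*}\widetilde T_a\widetilde\pi_1^*$ is a unitary operator $L^2(S^*M_1,\mu_{L_1})\to L^2(S^*M_2,\mu_{L_2})$, with adjoint $\displaystyle \widetilde U_A^*=\frac1{\#H_1}\sum_{a\in G}\overline{A(a)}\,\widetilde\pi_{1*}\widetilde T_{a^{-1}}\widetilde\pi_2^*$; on functions $\widetilde U_A$ and $\widetilde U_A^*$ are inverse to each other, and both map $C^\infty$ functions to $C^\infty$ functions; (2) for every $t\in\mathbb R$, $$\widetilde U_A\,V^t_{g_1}\,\widetilde U_A^*=V^t_{g_2},$$ pointwise for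 all functions on $S^*M_2$ (in particular on $C^\infty(S^*M_2)$), and as operators on $L^2(S^*M_2,\mu_{L_2})$. -/

import Mathlib

open Manifold Bundle MeasureTheory
open scoped ContDiff

noncomputable section

/-- The cotangent bundle `T^*M` of an `n`-dimensional manifold, as a smooth vector bundle. -/
abbrev CotangentBundle (n : ℕ) (M : Type*) [TopologicalSpace M]
    [ChartedSpace (EuclideanSpace ℝ (Fin n)) M] [IsManifold (𝓡 n) ∞ M] : Type _ :=
  TotalSpace (EuclideanSpace ℝ (Fin n) →L[ℝ] ℝ)
    (fun x : M => TangentSpace (𝓡 n) x →L[ℝ] Trivial M ℝ x)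

/-- Smooth Riemannian metrics on `M`. -/
abbrev SmoothMetric (n : ℕ) (M : Type*) [TopologicalSpace M]
    [ChartedSpace (EuclideanSpace ℝ (Fin n)) M] [IsManifold (𝓡 n) ∞ M] : Type _ :=
  ContMDiffRiemannianMetric (𝓡 n) ∞ (EuclideanSpace ℝ (Fin n))
    (fun x : M => TangentSpace (𝓡 n) x)

section Geometry

variable {n : ℕ} {M : Type*} [TopologicalSpace M]
  [ChartedSpace (EuclideanSpace ℝ (Fin n)) M] [IsManifold (𝓡 n) ∞ M]
  {N : Type*} [TopologicalSpace N]
  [ChartedSpace (EuclideanSpace ℝ (Fin n)) N] [IsManifold (𝓡 n) ∞ N]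

/-- `T^*M` carries its Borel sigma-algebra. -/
instance CotangentBundle.instMeasurableSpace : MeasurableSpace (CotangentBundle n M) := borel _

instance CotangentBundle.instBorelSpace : BorelSpace (CotangentBundle n M) := ⟨rfl⟩

/-- The musical isomorphism `v ↦ g_x(v, ·)` from the tangent to the cotangent space at `x`. -/
def flat (g : SmoothMetric n M) (x : M) :
    TangentSpace (𝓡 n) x ≃ₗ[ℝ] (TangentSpace (𝓡 n) x →L[ℝ] ℝ) :=
  LinearEquiv.ofBijective (g.inner x).toLinearMap (by
    have inj : Function.Injective (g.inner x).toLinearMap := by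
      rw [← LinearMap.ker_eq_bot, LinearMap.ker_eq_bot']
      intro v hv
      by_contra hne
      have h := g.pos x v hne
      have h2 : g.inner x v v = 0 := by
        have := congrArg (fun L : TangentSpace (𝓡 n) x →L[ℝ] ℝ => L v) hv
        simpa using this
      linarith
    refine ⟨inj, ?_⟩
    have : FiniteDimensional ℝ (TangentSpace (𝓡 n) x) :=
      inferInstanceAs (FiniteDimensional ℝ (EuclideanSpace ℝ (Fin n)))
    have : FiniteDimensional ℝ (TangentSpace (𝓡 n) x →L[ℝ] ℝ) :=
      inferInstanceAs (FiniteDimensional ℝ (EuclideanSpace ℝ (Fin n) →L[ℝ] ℝ))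
    refine (LinearMap.injective_iff_surjective_of_finrank_eq_finrank ?_).1 inj
    change Module.finrank ℝ (EuclideanSpace ℝ (Fin n))
      = Module.finrank ℝ (EuclideanSpace ℝ (Fin n) →L[ℝ] ℝ)
    rw [← (LinearMap.toContinuousLinearMap (𝕜 := ℝ) (E := EuclideanSpace ℝ (Fin n))
      (F' := ℝ)).finrank_eq]
    exact (Subspace.dual_finrank_eq).symm)

/-- The dual metric `|ξ|_g ^ 2 = g^{ab} ξ_a ξ_b`, that is `ξ` evaluated at its metric dual vector. -/
def conormSq (g : SmoothMetric n M) (ζ : CotangentBundle n M) : ℝ :=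
  ζ.2 ((flat g ζ.proj).symm ζ.2)

/-- The Hamiltonian `H(x, ξ) = |ξ|_g ^ 2 / 2`. -/
def hamiltonian (g : SmoothMetric n M) (ζ : CotangentBundle n M) : ℝ :=
  conormSq g ζ / 2

/-- The unit cosphere bundle `S^*M`, with the topology and Borel sigma-algebra
induced from `T^*M`. -/
abbrev CosphereBundle (g : SmoothMetric n M) : Type _ :=
  {ζ : CotangentBundle n M // conormSq g ζ = 1}

/-! ### Canonical coordinates on the cotangent bundle -/

/-- The coordinates `(q, p)` of a covector `ξ = p_a dx^a` over the domain of the chart `e` of `M`: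
`q = e x` and `p_a = ξ(∂/∂x^a)`. -/
def canonicalCoord (e : OpenPartialHomeomorph M (EuclideanSpace ℝ (Fin n)))
    (ζ : CotangentBundle n M) : EuclideanSpace ℝ (Fin n) × EuclideanSpace ℝ (Fin n) :=
  (e ζ.proj, WithLp.toLp 2 fun a =>
    ζ.2 ((mfderiv (𝓡 n) (𝓡 n) e ζ.proj).inverse
      (EuclideanSpace.single a (1 : ℝ) : EuclideanSpace ℝ (Fin n))))

/-- The covector `p_a dx^a` at the point with coordinates `q` in the chart `e`. -/
def ofCanonicalCoord (e : OpenPartialHomeomorph M (EuclideanSpace ℝ (Fin n)))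
    (z : EuclideanSpace ℝ (Fin n) × EuclideanSpace ℝ (Fin n)) : CotangentBundle n M :=
  ⟨e.symm z.1,
    ContinuousLinearMap.comp (innerSL ℝ z.2 : EuclideanSpace ℝ (Fin n) →L[ℝ] ℝ)
      (mfderiv (𝓡 n) (𝓡 n) e (e.symm z.1))⟩

/-- The Hamiltonian in canonical coordinates. -/
def coordHamiltonian (g : SmoothMetric n M)
    (e : OpenPartialHomeomorph M (EuclideanSpace ℝ (Fin n)))
    (q p : EuclideanSpace ℝ (Fin n)) : ℝ :=
  hamiltonian g (ofCanonicalCoord e (q, p))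

/-- A curve in `S^*M` is an orbit of the Hamiltonian (co-geodesic) flow if it is continuous and
satisfies Hamilton's equations `dq^a/dt = ∂H/∂p_a`, `dp_a/dt = - ∂H/∂q^a` in the canonical
coordinates of every smooth chart. -/
def IsHamiltonianOrbit (g : SmoothMetric n M) (γ : ℝ → CosphereBundle g) : Prop :=
  Continuous γ ∧
  ∀ e ∈ IsManifold.maximalAtlas (𝓡 n) ∞ M, ∀ t : ℝ, (γ t).1.proj ∈ e.source →
    HasDerivAt (fun s => (canonicalCoord e (γ s).1).1)
      (gradient (fun p => coordHamiltonian g e (canonicalCoord e (γ t).1).1 p)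
        (canonicalCoord e (γ t).1).2) t ∧
    HasDerivAt (fun s => (canonicalCoord e (γ s).1).2)
      (-gradient (fun q => coordHamiltonian g e q (canonicalCoord e (γ t).1).2)
        (canonicalCoord e (γ t).1).1) t

open Classical in
/-- The Hamiltonian (co-geodesic) flow `G^t_g` on `S^*M`. On a closed manifold there is exactly one
orbit through every point, so that the second branch never occurs. -/
def hamiltonianFlow (g : SmoothMetric n M) (t : ℝ) (ζ : CosphereBundle g) : CosphereBundle g :=
  if h : ∃ γ : ℝ → CosphereBundle g, IsHamiltonianOrbit g γ ∧ γ 0 = ζ then h.choose t else ζ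

/-- The Koopman operator `V^t_g f = f ∘ G^t_g` on functions. -/
def koopman (g : SmoothMetric n M) (t : ℝ) (f : CosphereBundle g → ℂ) : CosphereBundle g → ℂ :=
  f ∘ hamiltonianFlow g t

/-- Smooth functions on the closed submanifold `S^*M` of `T^*M`: the restrictions of smooth
functions on `T^*M`. -/
def IsSmoothOnCosphere (g : SmoothMetric n M) (f : CosphereBundle g → ℂ) : Prop :=
  ∃ F : CotangentBundle n M → ℂ,
    ContMDiff ((𝓡 n).prod 𝓘(ℝ, EuclideanSpace ℝ (Fin n) →L[ℝ] ℝ)) 𝓘(ℝ, ℂ) ∞ F ∧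
      ∀ ζ : CosphereBundle g, f ζ = F ζ.1

/-! ### Liouville measure -/

/-- The symplectic volume of `T^*M`: the measure which is `dq dp` in all canonical
coordinates (the supremum glues these compatible local measures). -/
def symplecticVolume (n : ℕ) (M : Type*) [TopologicalSpace M]
    [ChartedSpace (EuclideanSpace ℝ (Fin n)) M] [IsManifold (𝓡 n) ∞ M] :
    Measure (CotangentBundle n M) :=
  ⨆ e ∈ IsManifold.maximalAtlas (𝓡 n) ∞ M,
    ((volume : Measure (EuclideanSpace ℝ (Fin n) × EuclideanSpace ℝ (Fin n))).restrict
      (e.target ×ˢ Set.univ)).map (ofCanonicalCoord e)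

/-- The unit coball bundle without its zero section. -/
abbrev PuncturedCoball (g : SmoothMetric n M) : Type _ :=
  {ζ : CotangentBundle n M // 0 < conormSq g ζ ∧ conormSq g ζ ≤ 1}

lemma conormSq_smul (g : SmoothMetric n M) (x : M) (c : ℝ)
    (ξ : TangentSpace (𝓡 n) x →L[ℝ] ℝ) :
    conormSq g ⟨x, c • ξ⟩ = c ^ 2 * conormSq g ⟨x, ξ⟩ := by
  change (c • ξ) ((flat g x).symm (c • ξ)) = c ^ 2 * ξ ((flat g x).symm ξ)
  rw [map_smul, _root_.smul_apply, map_smul, smul_eq_mul, smul_eq_mul]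
  ring

/-- The radial projection `(x, ξ) ↦ (x, ξ / |ξ|)` to the cosphere bundle. -/
def radialProjection (g : SmoothMetric n M) (ζ : PuncturedCoball g) : CosphereBundle g :=
  ⟨⟨ζ.1.proj, (Real.sqrt (conormSq g ζ.1))⁻¹ • ζ.1.2⟩, by
    refine (conormSq_smul g ζ.1.proj _ ζ.1.2).trans ?_
    rw [inv_pow, Real.sq_sqrt ζ.2.1.le]
    exact inv_mul_cancel₀ ζ.2.1.ne'⟩

/-- The Liouville measure of a Borel subset of `S^*M`, up to the factor `n`: the symplectic volume
of the part of the cone over it that lies in the unit coball bundle. -/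
def coneMeasure (g : SmoothMetric n M) : Measure (CosphereBundle g) :=
  ((symplecticVolume n M).comap (Subtype.val : PuncturedCoball g → CotangentBundle n M)).map
    (radialProjection g)

/-- The normalized Liouville measure `μ_L` on `S^*M` (total mass one). -/
def liouvilleMeasure (g : SmoothMetric n M) : Measure (CosphereBundle g) :=
  (coneMeasure g Set.univ)⁻¹ • coneMeasure g

/-- `V` is the Koopman operator `V^t_g` on `L^2(S^*M, μ_L)`: it maps the class of a
square-integrable function `f` to the class of `f ∘ G^t_g`. -/
def IsKoopmanL2 (g : SmoothMetric n M) (t : ℝ)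
    (V : Lp ℂ 2 (liouvilleMeasure g) →L[ℂ] Lp ℂ 2 (liouvilleMeasure g)) : Prop :=
  ∀ (f : CosphereBundle g → ℂ) (hf : MemLp f 2 (liouvilleMeasure g)),
    V (hf.toLp f) =ᵐ[liouvilleMeasure g] koopman g t f

/-! ### Riemannian coverings and their lifts to cosphere bundles -/

/-- `f : (M, g) → (N, g')` is a local diffeomorphism with `f^* g' = g`. -/
structure IsRiemannianLocalIsometry (g : SmoothMetric n M) (g' : SmoothMetric n N)
    (f : M → N) : Prop where
  isLocalDiffeomorph : IsLocalDiffeomorph (𝓡 n) (𝓡 n) ∞ f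
  pullback_metric : ∀ (x : M) (v w : TangentSpace (𝓡 n) x),
    g'.inner (f x) (mfderiv (𝓡 n) (𝓡 n) f x v) (mfderiv (𝓡 n) (𝓡 n) f x w) = g.inner x v w

/-- `f : (M, g) → (N, g')` is the Riemannian covering with `N = K \ M`: a surjective covering map
and local isometry whose fibres are the orbits of the group `K` acting on `M`. -/
structure IsRiemannianQuotient (K : Type*) [Group K] [MulAction K M]
    (g : SmoothMetric n M) (g' : SmoothMetric n N) (f : M → N) : Prop where
  isCoveringMap : IsCoveringMap f
  surjective : Function.Surjective f
  isLocalIsometry : IsRiemannianLocalIsometry g g' f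
  fibre_eq_orbit : ∀ x y : M, f x = f y ↔ ∃ k : K, k • x = y

/-- The lift `(x, ξ) ↦ (f x, ξ ∘ (df_x)⁻¹)` of a local diffeomorphism to cotangent bundles. -/
def cotangentLift (f : M → N) (ζ : CotangentBundle n M) : CotangentBundle n N :=
  ⟨f ζ.proj, ContinuousLinearMap.comp
    (ζ.2 : TangentSpace (𝓡 n) ζ.proj →L[ℝ] ℝ) (mfderiv (𝓡 n) (𝓡 n) f ζ.proj).inverse⟩

lemma conormSq_cotangentLift {g : SmoothMetric n M} {g' : SmoothMetric n N} {f : M → N}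
    (hf : IsRiemannianLocalIsometry g g' f) (ζ : CotangentBundle n M) :
    conormSq g' (cotangentLift f ζ) = conormSq g ζ := by
  obtain ⟨x, ξ⟩ := ζ
  let L : TangentSpace (𝓡 n) x ≃L[ℝ] TangentSpace (𝓡 n) (f x) :=
    (hf.isLocalDiffeomorph x).mfderivToContinuousLinearEquiv (by simp)
  have hL : (L : TangentSpace (𝓡 n) x →L[ℝ] TangentSpace (𝓡 n) (f x))
      = mfderiv (𝓡 n) (𝓡 n) f x :=
    (hf.isLocalDiffeomorph x).mfderivToContinuousLinearEquiv_coe (by simp)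
  let η : TangentSpace (𝓡 n) (f x) →L[ℝ] ℝ :=
    ContinuousLinearMap.comp (ξ : TangentSpace (𝓡 n) x →L[ℝ] ℝ)
      (mfderiv (𝓡 n) (𝓡 n) f x).inverse
  have hη : ∀ w, η w = ξ (L.symm w) := by
    intro w
    change ξ ((mfderiv (𝓡 n) (𝓡 n) f x).inverse w) = _
    rw [← hL, ContinuousLinearMap.inverse_equiv]
    rfl
  have key : (flat g' (f x)).symm η = L ((flat g x).symm ξ) := by
    rw [LinearEquiv.symm_apply_eq]
    ext w
    have h1 := hf.pullback_metric x ((flat g x).symm ξ) (L.symm w)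
    rw [← hL] at h1
    have h2 : (L : TangentSpace (𝓡 n) x →L[ℝ] TangentSpace (𝓡 n) (f x)) (L.symm w) = w :=
      L.apply_symm_apply w
    rw [h2] at h1
    rw [hη]
    refine Eq.trans ?_ h1.symm
    have h3 := (flat g x).apply_symm_apply ξ
    exact (congrArg (fun T : TangentSpace (𝓡 n) x →L[ℝ] ℝ => T (L.symm w)) h3).symm
  change η ((flat g' (f x)).symm η) = ξ ((flat g x).symm ξ)
  rw [key, hη, L.symm_apply_apply]

/-- The lift of a local isometry to the unit cosphere bundles. -/
def cosphereLift {g : SmoothMetric n M} {g' : SmoothMetric n N} {f : M → N}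
    (hf : IsRiemannianLocalIsometry g g' f) (ζ : CosphereBundle g) : CosphereBundle g' :=
  ⟨cotangentLift f ζ.1, (conormSq_cotangentLift hf ζ.1).trans ζ.2⟩

end Geometry

/-- The push-forward of functions along a finite covering: summation over the fibres. -/
def fibreSum {X Y : Type*} (f : X → Y) (F : X → ℂ) (y : Y) : ℂ :=
  ∑ᶠ x ∈ f ⁻¹' {y}, F x

/-! ### The representation-theoretic condition -/

section Representation

variable {G : Type*} [Group G] [Fintype G]

/-- The Hilbert space `L^2(G/H)` of functions on the left cosets (counting measure). -/
abbrev L2Coset (H : Subgroup G) : Type _ := EuclideanSpace ℂ (G ⧸ H)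

/-- The quasi-regular representation of `G` on `L^2(G/H)`: `(a · φ)(x) = φ(a⁻¹ x)`. -/
def cosetTranslate (H : Subgroup G) (a : G) (φ : L2Coset H) : L2Coset H :=
  WithLp.toLp 2 fun x => φ (a⁻¹ • x)

open Classical in
/-- A unitary equivalence of the `G`-modules `L^2(G/H₁)` and `L^2(G/H₂)`. -/
structure UnitaryModuleEquiv (H₁ H₂ : Subgroup G) where
  toEquiv : L2Coset H₁ ≃ₗᵢ[ℂ] L2Coset H₂
  equivariant : ∀ (a : G) (φ : L2Coset H₁),
    toEquiv (cosetTranslate H₁ a φ) = cosetTranslate H₂ a (toEquiv φ)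

/-- Sunada's condition: `L^2(G/H₁)` and `L^2(G/H₂)` are unitarily equivalent `G`-modules. -/
def SunadaCondition (H₁ H₂ : Subgroup G) : Prop :=
  Nonempty (UnitaryModuleEquiv H₁ H₂)

/-- `A` is a function on `H₂ \ G / H₁` which is the convolution kernel of a unitary
intertwining operator `𝒜 : L^2(G/H₁) → L^2(G/H₂)`, namely
`(𝒜 φ)(x H₂) = ∑_{a ∈ G} A(a) φ(x a H₁)`. -/
structure IsUnitaryIntertwiningKernel (H₁ H₂ : Subgroup G) (A : G → ℂ) : Prop where
  biinvariant : ∀ (b₂ : H₂) (a : G) (b₁ : H₁), A (b₂ * a * b₁) = A a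
  unitary : ∃ 𝒜 : UnitaryModuleEquiv H₁ H₂, ∀ (φ : L2Coset H₁) (x : G),
    𝒜.toEquiv φ (x : G ⧸ H₂) = ∑ a : G, A a * φ ((x * a : G) : G ⧸ H₁)

end Representation

/-! ### The lifted finite Radon transform -/

section Radon

variable {n : ℕ} {G : Type*} [Group G] [Fintype G]
  {M M₁ M₂ : Type*}
  [TopologicalSpace M] [ChartedSpace (EuclideanSpace ℝ (Fin n)) M] [IsManifold (𝓡 n) ∞ M]
  [TopologicalSpace M₁] [ChartedSpace (EuclideanSpace ℝ (Fin n)) M₁] [IsManifold (𝓡 n) ∞ M₁]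
  [TopologicalSpace M₂] [ChartedSpace (EuclideanSpace ℝ (Fin n)) M₂] [IsManifold (𝓡 n) ∞ M₂]
  [MulAction G M]
  {g : SmoothMetric n M} {g₁ : SmoothMetric n M₁} {g₂ : SmoothMetric n M₂}
  {pr₁ : M → M₁} {pr₂ : M → M₂}

/-- Translation of functions on `S^*M` by a group element acting by isometries:
`(T_a F)(ζ) = F(a⁻¹ · ζ)`, where `a · (x, ξ) = (a x, (a⁻¹)^* ξ)`. -/
def deckTranslate (hG : ∀ a : G, IsRiemannianLocalIsometry g g (fun x : M => a • x)) (a : G)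
    (F : CosphereBundle g → ℂ) : CosphereBundle g → ℂ :=
  fun ζ => F (cosphereLift (hG a⁻¹) ζ)

/-- The lifted finite Radon transform
`U_A = (1 / #H₁) ∑_{a ∈ G} A(a) pr₂_* T_a pr₁^*`, from functions on `S^*M₁` to functions
on `S^*M₂`. -/
def radonTransform (H₁ : Subgroup G)
    (hG : ∀ a : G, IsRiemannianLocalIsometry g g (fun x : M => a • x))
    (h₁ : IsRiemannianLocalIsometry g g₁ pr₁) (h₂ : IsRiemannianLocalIsometry g g₂ pr₂)
    (A : G → ℂ) (f : CosphereBundle g₁ → ℂ) : CosphereBundle g₂ → ℂ :=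
  fun ζ => (1 / (Nat.card H₁ : ℂ)) *
    ∑ a : G, A a * fibreSum (cosphereLift h₂) (deckTranslate hG a (f ∘ cosphereLift h₁)) ζ

/-- The adjoint transform
`U_A^* = (1 / #H₁) ∑_{a ∈ G} conj(A(a)) pr₁_* T_{a⁻¹} pr₂^*`, from functions on `S^*M₂` to
functions on `S^*M₁`. -/
def radonTransformAdjoint (H₁ : Subgroup G)
    (hG : ∀ a : G, IsRiemannianLocalIsometry g g (fun x : M => a • x))
    (h₁ : IsRiemannianLocalIsometry g g₁ pr₁) (h₂ : IsRiemannianLocalIsometry g g₂ pr₂)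
    (A : G → ℂ) (f : CosphereBundle g₂ → ℂ) : CosphereBundle g₁ → ℂ :=
  fun ζ => (1 / (Nat.card H₁ : ℂ)) *
    ∑ a : G, (starRingEnd ℂ) (A a) *
      fibreSum (cosphereLift h₁) (deckTranslate hG a⁻¹ (f ∘ cosphereLift h₂)) ζ

end Radon

end

/-!
Everything takes place on the `G`-orbits of `S^*M`. The group acts freely on `S^*M` by the lifted
isometries, and the lift of the quotient map `M → Mᵢ` identifies `S^*Mᵢ` with `Hᵢ \ S^*M`. The sum
over the fibres of `S^*M → S^*M₂` merely repeats one and the same sum `#H₂ = #H₁` times, because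
`A` is left `H₂`-invariant. Hence the transform of `f` at the image of `x` is
`∑ a, A a * f [a⁻¹ • x]` (`orbitRadon_eq_fibreSum`). Restricted to one orbit, with functions on it
read as functions on `G/H₁` and `G/H₂`, this is the intertwining operator with kernel `A`
(`orbitRestrict_orbitRadon`). Three consequences follow.

* The operator on `L²(G/H₁)` is unitary, so that its inverse is its adjoint, which has the kernel
  `a ↦ conj (A a⁻¹)`; hence the two transforms are inverse to each other on all functions
  (`orbitRadon_adjointKernel_orbitRadon`). Integrating the identity of norms on orbits over `S^*M`
  gives the isometry of the `L²` spaces (`exists_unitary_orbitRadon`), provided that the Liouville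
  measure is preserved by `G` and pushed forward to the Liouville measures of the quotients
  (`measurePreserving_cosphereLift`). The latter holds because local diffeomorphisms are the
  identity in corresponding canonical coordinates, hence preserve `dq dp`, and because the
  normalization removes the number of sheets.
* Each term `f ∘ S^*(M → M₁) ∘ a⁻¹` is smooth if `f` is, and smoothness descends along the local
  diffeomorphism `T^*M → T^*M₂` (`isSmoothOnCosphere_orbitRadon`).
* Isometries and Riemannian coverings commute with the Hamiltonian flows, since orbits can be pushed
  forward, lifted through coverings, and are determined by their initial values
  (`cosphereLift_hamiltonianFlow`). Therefore the transform intertwines the Koopman operators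
  (`orbitRadon_koopman`).
-/

noncomputable section

open Filter Topology Set

set_option linter.unusedSectionVars false

/-! ### Smooth partial diffeomorphisms -/

section CanonicalCoordinates

variable {n : ℕ} {M : Type*} [TopologicalSpace M]
  [ChartedSpace (EuclideanSpace ℝ (Fin n)) M] [IsManifold (𝓡 n) ∞ M]
  {N : Type*} [TopologicalSpace N]
  [ChartedSpace (EuclideanSpace ℝ (Fin n)) N] [IsManifold (𝓡 n) ∞ N]
  {N' : Type*} [TopologicalSpace N']
  [ChartedSpace (EuclideanSpace ℝ (Fin n)) N'] [IsManifold (𝓡 n) ∞ N']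

/-- A diffeomorphism between an open subset of `M` and an open subset of `N`. Smooth charts are
the special case in which `N` is the model space. -/
structure IsSmoothPartialDiffeo (n : ℕ) {M N : Type*} [TopologicalSpace M]
    [ChartedSpace (EuclideanSpace ℝ (Fin n)) M] [TopologicalSpace N]
    [ChartedSpace (EuclideanSpace ℝ (Fin n)) N] (P : OpenPartialHomeomorph M N) : Prop where
  contMDiffOn : ContMDiffOn (𝓡 n) (𝓡 n) ∞ P P.source
  contMDiffOn_symm : ContMDiffOn (𝓡 n) (𝓡 n) ∞ P.symm P.target

namespace IsSmoothPartialDiffeo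

variable {P : OpenPartialHomeomorph M N} {Q : OpenPartialHomeomorph N N'}

lemma symm (hP : IsSmoothPartialDiffeo n P) : IsSmoothPartialDiffeo n P.symm :=
  ⟨hP.contMDiffOn_symm, by simpa using hP.contMDiffOn⟩

lemma trans (hP : IsSmoothPartialDiffeo n P) (hQ : IsSmoothPartialDiffeo n Q) :
    IsSmoothPartialDiffeo n (P.trans Q) := by
  refine ⟨?_, ?_⟩
  · refine hQ.contMDiffOn.comp (hP.contMDiffOn.mono ?_) ?_
    · intro x hx
      simp only [mfld_simps] at hx
      exact hx.1
    · intro x hx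
      simp only [mfld_simps] at hx
      exact hx.2
  · refine hP.contMDiffOn_symm.comp (hQ.contMDiffOn_symm.mono ?_) ?_
    · intro x hx
      simp only [mfld_simps] at hx
      exact hx.1
    · intro x hx
      simp only [mfld_simps] at hx
      exact hx.2

lemma of_mem_maximalAtlas {e : OpenPartialHomeomorph M (EuclideanSpace ℝ (Fin n))}
    (he : e ∈ IsManifold.maximalAtlas (𝓡 n) ∞ M) : IsSmoothPartialDiffeo n e :=
  ⟨contMDiffOn_of_mem_maximalAtlas he, contMDiffOn_symm_of_mem_maximalAtlas he⟩

lemma mem_maximalAtlas {e : OpenPartialHomeomorph M (EuclideanSpace ℝ (Fin n))}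
    (he : IsSmoothPartialDiffeo n e) : e ∈ IsManifold.maximalAtlas (𝓡 n) ∞ M :=
  e.mem_maximalAtlas_of_contMDiffOn he.contMDiffOn he.contMDiffOn_symm

lemma mdifferentiable (hP : IsSmoothPartialDiffeo n P) : P.MDifferentiable (𝓡 n) (𝓡 n) :=
  ⟨hP.contMDiffOn.mdifferentiableOn (by simp), hP.contMDiffOn_symm.mdifferentiableOn (by simp)⟩

lemma isInvertible_mfderiv (hP : IsSmoothPartialDiffeo n P) {x : M} (hx : x ∈ P.source) :
    (mfderiv (𝓡 n) (𝓡 n) P x).IsInvertible :=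
  ⟨hP.mdifferentiable.mfderiv hx, rfl⟩

lemma mfderiv_symm_comp (hP : IsSmoothPartialDiffeo n P) {x : M} (hx : x ∈ P.source)
    (v : TangentSpace (𝓡 n) x) :
    mfderiv (𝓡 n) (𝓡 n) P.symm (P x) (mfderiv (𝓡 n) (𝓡 n) P x v) = v :=
  DFunLike.congr_fun (hP.mdifferentiable.symm_comp_deriv hx) v

lemma inverse_mfderiv (hP : IsSmoothPartialDiffeo n P) {x : M} (hx : x ∈ P.source) :
    (mfderiv (𝓡 n) (𝓡 n) P x).inverse = mfderiv (𝓡 n) (𝓡 n) P.symm (P x) := by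
  ext1 w
  obtain ⟨v, rfl⟩ := hP.mdifferentiable.mfderiv_surjective hx w
  refine Eq.trans ?_ (hP.mfderiv_symm_comp hx v).symm
  rw [(hP.isInvertible_mfderiv hx).inverse_apply_eq]

lemma of_isLocalDiffeomorphAt {f : M → N} {x : M}
    (hf : IsLocalDiffeomorphAt (𝓡 n) (𝓡 n) ∞ f x) :
    ∃ P : OpenPartialHomeomorph M N, IsSmoothPartialDiffeo n P ∧ x ∈ P.source ∧
      EqOn f P P.source := by
  obtain ⟨Φ, hx, hΦ⟩ := hf
  exact ⟨Φ.toOpenPartialHomeomorph, ⟨Φ.contMDiffOn_toFun, Φ.contMDiffOn_invFun⟩, hx, hΦ⟩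

end IsSmoothPartialDiffeo

/-! ### Functoriality of the cotangent lift -/

lemma cotangentLift_congr {f f' : M → N} {ζ : CotangentBundle n M}
    (h : f =ᶠ[𝓝 ζ.proj] f') : cotangentLift f ζ = cotangentLift f' ζ := by
  let mk (y : N) (T : EuclideanSpace ℝ (Fin n) →L[ℝ] EuclideanSpace ℝ (Fin n)) :
      CotangentBundle n N :=
    ⟨y, ContinuousLinearMap.comp
      (ζ.2 : EuclideanSpace ℝ (Fin n) →L[ℝ] ℝ) (T.inverse)⟩
  have h2 : @Eq (EuclideanSpace ℝ (Fin n) →L[ℝ] EuclideanSpace ℝ (Fin n))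
    (mfderiv (𝓡 n) (𝓡 n) f ζ.proj) (mfderiv (𝓡 n) (𝓡 n) f' ζ.proj) := h.mfderiv_eq
  exact congrArg₂ mk h.self_of_nhds h2

lemma cotangentLift_id (ζ : CotangentBundle n M) : cotangentLift (id : M → M) ζ = ζ := by
  obtain ⟨x, ξ⟩ := ζ
  change (⟨x, _⟩ : CotangentBundle n M) = ⟨x, ξ⟩
  congr 1
  rw [mfderiv_id]
  change ContinuousLinearMap.comp ξ
    (ContinuousLinearMap.id ℝ (TangentSpace (𝓡 n) x)).inverse = ξ
  rw [ContinuousLinearMap.inverse_id]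
  rfl

/-- Only the inner map needs an invertible differential: `inverse` is zero on non-invertible maps,
so that both sides have the zero covector if the outer differential is not invertible. -/
lemma cotangentLift_comp {f : N → N'} {h : M → N} {ζ : CotangentBundle n M}
    (hf : MDifferentiableAt (𝓡 n) (𝓡 n) f (h ζ.proj))
    (hh : MDifferentiableAt (𝓡 n) (𝓡 n) h ζ.proj)
    (hinv : (mfderiv (𝓡 n) (𝓡 n) h ζ.proj).IsInvertible) :
    cotangentLift (f ∘ h) ζ = cotangentLift f (cotangentLift h ζ) := by
  obtain ⟨x, ξ⟩ := ζ
  change (⟨f (h x), _⟩ : CotangentBundle n N') = ⟨f (h x), _⟩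
  congr 1
  rw [mfderiv_comp x hf hh]
  change ContinuousLinearMap.comp ξ (ContinuousLinearMap.inverse _) = ContinuousLinearMap.comp
    (ContinuousLinearMap.comp ξ (ContinuousLinearMap.inverse _)) (ContinuousLinearMap.inverse _)
  rw [ContinuousLinearMap.IsInvertible.inverse_comp_of_right hinv]
  rfl

lemma IsSmoothPartialDiffeo.cotangentLift_symm {P : OpenPartialHomeomorph M N}
    (hP : IsSmoothPartialDiffeo n P) {ζ : CotangentBundle n M} (hζ : ζ.proj ∈ P.source) :
    cotangentLift P.symm (cotangentLift P ζ) = ζ := by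
  rw [← cotangentLift_comp (hP.mdifferentiable.mdifferentiableAt_symm (P.map_source hζ))
    (hP.mdifferentiable.mdifferentiableAt hζ) (hP.isInvertible_mfderiv hζ)]
  refine (cotangentLift_congr ?_).trans (cotangentLift_id ζ)
  filter_upwards [P.open_source.mem_nhds hζ] with x hx using P.left_inv hx

/-! ### Canonical coordinates -/

/-- In canonical coordinates the lift of a local diffeomorphism is the identity. -/
lemma canonicalCoord_cotangentLift {P : OpenPartialHomeomorph M N} (hP : IsSmoothPartialDiffeo n P)
    {e : OpenPartialHomeomorph N (EuclideanSpace ℝ (Fin n))} (he : IsSmoothPartialDiffeo n e)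
    {ζ : CotangentBundle n M} (hζ : ζ.proj ∈ (P.trans e).source) :
    canonicalCoord e (cotangentLift P ζ) = canonicalCoord (P.trans e) ζ := by
  simp only [mfld_simps] at hζ
  have := cotangentLift_comp (he.mdifferentiable.mdifferentiableAt hζ.2)
    (hP.mdifferentiable.mdifferentiableAt hζ.1) (hP.isInvertible_mfderiv hζ.1)
  exact (congrArg (fun η : CotangentBundle n (EuclideanSpace ℝ (Fin n)) =>
    ((η.proj, WithLp.toLp 2 fun a => (η.2 (EuclideanSpace.single a (1 : ℝ)) : ℝ)) :
      EuclideanSpace ℝ (Fin n) × EuclideanSpace ℝ (Fin n))) this).symm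

lemma canonicalCoord_injOn {e : OpenPartialHomeomorph M (EuclideanSpace ℝ (Fin n))}
    (he : IsSmoothPartialDiffeo n e) {ζ ζ' : CotangentBundle n M} (hζ : ζ.proj ∈ e.source)
    (hζ' : ζ'.proj ∈ e.source) (h : canonicalCoord e ζ = canonicalCoord e ζ') : ζ = ζ' := by
  obtain ⟨x, ξ⟩ := ζ
  obtain ⟨x', ξ'⟩ := ζ'
  obtain rfl : x = x' := e.injOn hζ hζ' (congrArg Prod.fst h)
  congr 1
  have h2 : ContinuousLinearMap.comp ξ (mfderiv (𝓡 n) (𝓡 n) e x).inverse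
      = ContinuousLinearMap.comp ξ' (mfderiv (𝓡 n) (𝓡 n) e x).inverse := by
    have key : (ContinuousLinearMap.comp ξ (mfderiv (𝓡 n) (𝓡 n) e x).inverse).toLinearMap
      = (ContinuousLinearMap.comp ξ' (mfderiv (𝓡 n) (𝓡 n) e x).inverse).toLinearMap := by
      refine (EuclideanSpace.basisFun (Fin n) ℝ).toBasis.ext fun a => ?_
      have := congrFun (congrArg (fun p => WithLp.ofLp (Prod.snd p)) h) a
      rw [OrthonormalBasis.coe_toBasis, EuclideanSpace.basisFun_apply]
      exact this
    exact ContinuousLinearMap.coe_injective key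
  obtain ⟨L, hL⟩ := he.isInvertible_mfderiv hζ
  rw [← hL, ContinuousLinearMap.inverse_equiv] at h2
  ext v
  have := DFunLike.congr_fun h2 (L v)
  change ξ (L.symm (L v)) = ξ' (L.symm (L v)) at this
  rwa [L.symm_apply_apply] at this

lemma canonicalCoord_ofCanonicalCoord {e : OpenPartialHomeomorph M (EuclideanSpace ℝ (Fin n))}
    (he : IsSmoothPartialDiffeo n e) {z : EuclideanSpace ℝ (Fin n) × EuclideanSpace ℝ (Fin n)}
    (hz : z.1 ∈ e.target) : canonicalCoord e (ofCanonicalCoord e z) = z := by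
  obtain ⟨q, p⟩ := z
  have hs := e.map_target hz
  refine Prod.ext (e.right_inv hz) ?_
  ext a
  obtain ⟨L, hL⟩ := he.isInvertible_mfderiv hs
  change (innerSL ℝ p) (mfderiv (𝓡 n) (𝓡 n) e (e.symm q)
    ((mfderiv (𝓡 n) (𝓡 n) e (e.symm q)).inverse (EuclideanSpace.single a (1 : ℝ)))) = p a
  rw [← hL, ContinuousLinearMap.inverse_equiv]
  change (innerSL ℝ p) (L (L.symm (EuclideanSpace.single a (1 : ℝ)))) = p a
  have h1 := L.apply_symm_apply (EuclideanSpace.single a (1 : ℝ))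
  rw [h1]
  rw [innerSL_apply_apply, EuclideanSpace.inner_single_right]
  simp

lemma ofCanonicalCoord_canonicalCoord {e : OpenPartialHomeomorph M (EuclideanSpace ℝ (Fin n))}
    (he : IsSmoothPartialDiffeo n e) {ζ : CotangentBundle n M}
    (hζ : ζ.proj ∈ e.source) : ofCanonicalCoord e (canonicalCoord e ζ) = ζ := by
  have ht : (canonicalCoord e ζ).1 ∈ e.target := e.map_source hζ
  exact canonicalCoord_injOn he (e.map_target ht) hζ (canonicalCoord_ofCanonicalCoord he ht)

lemma cotangentLift_ofCanonicalCoord {P : OpenPartialHomeomorph M N}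
    (hP : IsSmoothPartialDiffeo n P)
    {e : OpenPartialHomeomorph N (EuclideanSpace ℝ (Fin n))} (he : IsSmoothPartialDiffeo n e)
    {z : EuclideanSpace ℝ (Fin n) × EuclideanSpace ℝ (Fin n)}
    (hz : z.1 ∈ (P.trans e).target) :
    cotangentLift P (ofCanonicalCoord (P.trans e) z) = ofCanonicalCoord e z := by
  have hs := (P.trans e).map_target hz
  have h1 : (ofCanonicalCoord (P.trans e) z).proj ∈ (P.trans e).source := hs
  have hz' := hz
  simp only [mfld_simps] at hz' hs
  refine canonicalCoord_injOn he hs.2 (e.map_target hz'.1) ?_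
  rw [canonicalCoord_cotangentLift hP he h1, canonicalCoord_ofCanonicalCoord (hP.trans he) hz,
    canonicalCoord_ofCanonicalCoord he hz'.1]

end CanonicalCoordinates

/-! ### Smoothness of canonical coordinates -/

lemma ContDiffOn.clm_inverse_apply {X E F : Type*} [NormedAddCommGroup X] [NormedSpace ℝ X]
    [NormedAddCommGroup E] [NormedSpace ℝ E] [CompleteSpace E]
    [NormedAddCommGroup F] [NormedSpace ℝ F] {k : WithTop ℕ∞} {B : X → E →L[ℝ] F} {c : X → F}
    {s : Set X} (hB : ContDiffOn ℝ k B s) (hinv : ∀ x ∈ s, (B x).IsInvertible)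
    (hc : ContDiffOn ℝ k c s) : ContDiffOn ℝ k (fun x => (B x).inverse (c x)) s :=
  ContDiffOn.clm_apply (fun x hx => (hinv x hx).contDiffAt_map_inverse.comp_contDiffWithinAt x
    (hB x hx)) hc

section SmoothCoordinates

variable {n : ℕ} {M : Type*} [TopologicalSpace M]
  [ChartedSpace (EuclideanSpace ℝ (Fin n)) M] [IsManifold (𝓡 n) ∞ M]
  {N : Type*} [TopologicalSpace N]
  [ChartedSpace (EuclideanSpace ℝ (Fin n)) N] [IsManifold (𝓡 n) ∞ N]
  {e : OpenPartialHomeomorph M (EuclideanSpace ℝ (Fin n))}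

lemma contMDiffOn_symm_coordVectorField (he : IsSmoothPartialDiffeo n e)
    (v : EuclideanSpace ℝ (Fin n)) :
    ContMDiffOn (𝓡 n) (𝓡 n).tangent ∞
      (fun q => (⟨e.symm q, mfderiv (𝓡 n) (𝓡 n) e.symm q v⟩ : TangentBundle (𝓡 n) M))
      e.target := by
  have h1 := he.contMDiffOn_symm.contMDiffOn_tangentMapWithin (m := ∞) (by simp)
    e.open_target.uniqueMDiffOn
  have h2 : ContMDiffOn (𝓡 n) (𝓡 n).tangent ∞
      (fun q => (⟨q, v⟩ : TangentBundle (𝓡 n) (EuclideanSpace ℝ (Fin n)))) e.target :=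
    contMDiffOn_vectorSpace_iff_contDiffOn.2 contDiffOn_const
  refine (h1.comp h2 fun q hq => hq).congr fun q hq => ?_
  simp only [Function.comp, tangentMapWithin]
  rw [mfderivWithin_of_isOpen e.open_target hq]

lemma contMDiffOn_coordVectorField (he : IsSmoothPartialDiffeo n e)
    (v : EuclideanSpace ℝ (Fin n)) :
    ContMDiffOn (𝓡 n) (𝓡 n).tangent ∞
      (fun x => (⟨x, (mfderiv (𝓡 n) (𝓡 n) e x).inverse v⟩ : TangentBundle (𝓡 n) M))
      e.source := by
  refine ((contMDiffOn_symm_coordVectorField he v).comp he.contMDiffOn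
    fun x hx => e.map_source hx).congr fun x hx => ?_
  let mk (y : M) (w : EuclideanSpace ℝ (Fin n)) : TangentBundle (𝓡 n) M := ⟨y, w⟩
  exact congrArg₂ mk (e.left_inv hx).symm (DFunLike.congr_fun (he.inverse_mfderiv hx) v)

lemma contMDiffOn_canonicalCoord (he : IsSmoothPartialDiffeo n e) :
    ContMDiffOn ((𝓡 n).prod 𝓘(ℝ, EuclideanSpace ℝ (Fin n) →L[ℝ] ℝ))
      𝓘(ℝ, EuclideanSpace ℝ (Fin n) × EuclideanSpace ℝ (Fin n)) ∞ (canonicalCoord e)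
      (TotalSpace.proj ⁻¹' e.source) := by
  have hp : ContMDiffOn ((𝓡 n).prod 𝓘(ℝ, EuclideanSpace ℝ (Fin n) →L[ℝ] ℝ)) (𝓡 n) ∞
    (fun ζ : CotangentBundle n M => ζ.proj) (TotalSpace.proj ⁻¹' e.source) := contMDiffOn_proj _
  refine ContMDiffOn.prodMk_space (he.contMDiffOn.comp hp fun ζ hζ => hζ) ?_
  have key : ∀ a : Fin n, ContMDiffOn ((𝓡 n).prod 𝓘(ℝ, EuclideanSpace ℝ (Fin n) →L[ℝ] ℝ)) 𝓘(ℝ, ℝ) ∞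
      (fun ζ : CotangentBundle n M => (ζ.2 ((mfderiv (𝓡 n) (𝓡 n) e ζ.proj).inverse
      (EuclideanSpace.single a (1 : ℝ) : EuclideanSpace ℝ (Fin n))) : ℝ))
      (TotalSpace.proj ⁻¹' e.source) := by
    intro a
    have hid : ContMDiffOn ((𝓡 n).prod 𝓘(ℝ, EuclideanSpace ℝ (Fin n) →L[ℝ] ℝ))
      ((𝓡 n).prod 𝓘(ℝ, EuclideanSpace ℝ (Fin n) →L[ℝ] ℝ)) ∞
      (fun ζ : CotangentBundle n M => TotalSpace.mk' (EuclideanSpace ℝ (Fin n) →L[ℝ] ℝ)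
        (E := fun x : M => TangentSpace (𝓡 n) x →L[ℝ] Trivial M ℝ x) ζ.proj ζ.2)
      (TotalSpace.proj ⁻¹' e.source) := contMDiffOn_id
    have hX := (contMDiffOn_coordVectorField he (EuclideanSpace.single a (1 : ℝ))).comp hp
      fun ζ hζ => hζ
    have := hid.clm_bundle_apply hX
    intro ζ hζ
    exact (contMDiffWithinAt_totalSpace.1 (this ζ hζ)).2
  have h2 : ContMDiffOn ((𝓡 n).prod 𝓘(ℝ, EuclideanSpace ℝ (Fin n) →L[ℝ] ℝ)) 𝓘(ℝ, Fin n → ℝ) ∞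
      (fun (ζ : CotangentBundle n M) a => (ζ.2 ((mfderiv (𝓡 n) (𝓡 n) e ζ.proj).inverse
      (EuclideanSpace.single a (1 : ℝ) : EuclideanSpace ℝ (Fin n))) : ℝ))
      (TotalSpace.proj ⁻¹' e.source) := contMDiffOn_pi_space.2 key
  exact ((EuclideanSpace.equiv (Fin n) ℝ).symm.contDiff.contMDiff (n := ∞)).comp_contMDiffOn h2

lemma contMDiffOn_ofCanonicalCoord (he : IsSmoothPartialDiffeo n e) :
    ContMDiffOn 𝓘(ℝ, EuclideanSpace ℝ (Fin n) × EuclideanSpace ℝ (Fin n))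
      ((𝓡 n).prod 𝓘(ℝ, EuclideanSpace ℝ (Fin n) →L[ℝ] ℝ)) ∞ (ofCanonicalCoord e)
      (e.target ×ˢ univ) := by
  intro z₀ hz₀
  refine ContMDiffAt.contMDiffWithinAt ?_
  have hfst : ContMDiffAt 𝓘(ℝ, EuclideanSpace ℝ (Fin n) × EuclideanSpace ℝ (Fin n)) (𝓡 n) ∞
    (fun z : EuclideanSpace ℝ (Fin n) × EuclideanSpace ℝ (Fin n) => z.1) z₀ :=
    contDiff_fst.contMDiff.contMDiffAt
  have hbase : ContMDiffAt 𝓘(ℝ, EuclideanSpace ℝ (Fin n) × EuclideanSpace ℝ (Fin n)) (𝓡 n) ∞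
      (fun z : EuclideanSpace ℝ (Fin n) × EuclideanSpace ℝ (Fin n) => e.symm z.1) z₀ :=
    (he.contMDiffOn_symm.contMDiffAt (e.open_target.mem_nhds hz₀.1)).comp z₀ hfst
  refine (contMDiffAt_hom_bundle _).2 ⟨hbase, ?_⟩
  have hD := (he.contMDiffOn.contMDiffAt
    (e.open_source.mem_nhds (e.map_target hz₀.1))).mfderiv_const (m := ∞) (by simp)
  have hD' := hD.comp z₀ hbase
  have hp : ContMDiffAt 𝓘(ℝ, EuclideanSpace ℝ (Fin n) × EuclideanSpace ℝ (Fin n))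
      𝓘(ℝ, EuclideanSpace ℝ (Fin n) →L[ℝ] ℝ) ∞
    (fun z : EuclideanSpace ℝ (Fin n) × EuclideanSpace ℝ (Fin n) =>
      (innerSL ℝ z.2 : EuclideanSpace ℝ (Fin n) →L[ℝ] ℝ)) z₀ :=
    ((innerSL ℝ).contDiff.comp contDiff_snd).contMDiff.contMDiffAt
  refine (hp.clm_comp hD').congr_of_eventuallyEq ?_
  refine Eventually.of_forall fun z => ?_
  ext v
  simp only [inTangentCoordinates, Function.comp_def]
  simp only [ContinuousLinearMap.inCoordinates]
  have h1 := TangentBundle.continuousLinearMapAt_model_space (𝕜 := ℝ) (e (e.symm z₀.1))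
    (e (e.symm z.1))
  have h2 : ∀ w : EuclideanSpace ℝ (Fin n), Trivialization.continuousLinearMapAt ℝ
      (trivializationAt (EuclideanSpace ℝ (Fin n)) (TangentSpace (𝓡 n)) (e (e.symm z₀.1)))
      (e (e.symm z.1)) w = w := fun w => DFunLike.congr_fun h1 w
  have h3 : ∀ w : ℝ, Trivialization.continuousLinearMapAt ℝ
      (trivializationAt ℝ (Trivial M ℝ) (e.symm z₀.1)) (e.symm z.1) w = w := fun w =>
    DFunLike.congr_fun (Bundle.Trivial.continuousLinearMapAt_trivialization ℝ M ℝ (e.symm z.1)) w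
  exact (h3 _).trans (congrArg (innerSL ℝ z.2) (h2 _).symm)

lemma IsSmoothPartialDiffeo.chartAt (x : M) :
    IsSmoothPartialDiffeo n (chartAt (EuclideanSpace ℝ (Fin n)) x) :=
  .of_mem_maximalAtlas (IsManifold.chart_mem_maximalAtlas x)

lemma IsSmoothPartialDiffeo.contMDiffOn_cotangentLift {P : OpenPartialHomeomorph M N}
    (hP : IsSmoothPartialDiffeo n P) :
    ContMDiffOn ((𝓡 n).prod 𝓘(ℝ, EuclideanSpace ℝ (Fin n) →L[ℝ] ℝ))
      ((𝓡 n).prod 𝓘(ℝ, EuclideanSpace ℝ (Fin n) →L[ℝ] ℝ)) ∞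
      (cotangentLift P : CotangentBundle n M → CotangentBundle n N)
      (TotalSpace.proj ⁻¹' P.source) := by
  intro ζ₀ hζ₀
  refine ContMDiffAt.contMDiffWithinAt ?_
  set e := _root_.chartAt (EuclideanSpace ℝ (Fin n)) (P ζ₀.proj) with he_def
  have he : IsSmoothPartialDiffeo n e := .chartAt _
  have hs : ζ₀.proj ∈ (P.trans e).source := by
    simpa only [mfld_simps] using ⟨hζ₀, mem_chart_source _ _⟩
  have hU : TotalSpace.proj ⁻¹' (P.trans e).source ∈ 𝓝 ζ₀ :=
    (FiberBundle.continuous_proj _ _).continuousAt.preimage_mem_nhds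
      ((P.trans e).open_source.mem_nhds hs)
  have hs' := hs
  simp only [mfld_simps] at hs'
  have h1 := (contMDiffOn_canonicalCoord (hP.trans he)).contMDiffAt hU
  have h2 := (contMDiffOn_ofCanonicalCoord he).contMDiffAt
    (x := canonicalCoord (P.trans e) ζ₀)
    ((e.open_target.prod isOpen_univ).mem_nhds ⟨e.map_source hs'.2, mem_univ _⟩)
  refine (h2.comp ζ₀ h1).congr_of_eventuallyEq ?_
  filter_upwards [hU] with ζ hζ
  have hζ' : ζ.proj ∈ (P.trans e).source := hζ
  rw [Function.comp, ← canonicalCoord_cotangentLift hP he hζ]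
  simp only [mfld_simps] at hζ'
  exact (ofCanonicalCoord_canonicalCoord he hζ'.2).symm

lemma contMDiff_cotangentLift {f : M → N} (hf : IsLocalDiffeomorph (𝓡 n) (𝓡 n) ∞ f) :
    ContMDiff ((𝓡 n).prod 𝓘(ℝ, EuclideanSpace ℝ (Fin n) →L[ℝ] ℝ))
      ((𝓡 n).prod 𝓘(ℝ, EuclideanSpace ℝ (Fin n) →L[ℝ] ℝ)) ∞
      (cotangentLift f : CotangentBundle n M → CotangentBundle n N) := by
  intro ζ
  obtain ⟨P, hP, hx, hfP⟩ := IsSmoothPartialDiffeo.of_isLocalDiffeomorphAt (hf ζ.proj)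
  have hU : TotalSpace.proj ⁻¹' P.source ∈ 𝓝 ζ :=
    (FiberBundle.continuous_proj _ _).continuousAt.preimage_mem_nhds (P.open_source.mem_nhds hx)
  refine (hP.contMDiffOn_cotangentLift.contMDiffAt hU).congr_of_eventuallyEq ?_
  filter_upwards [hU] with η hη
  exact cotangentLift_congr (hfP.eventuallyEq_of_mem (P.open_source.mem_nhds hη))

/-! ### The Hamiltonian in canonical coordinates -/

/-- The matrix `g_{ab}` of the metric in the chart `e`, as a bilinear form. -/
def coordMetric (g : SmoothMetric n M) (e : OpenPartialHomeomorph M (EuclideanSpace ℝ (Fin n)))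
    (q : EuclideanSpace ℝ (Fin n)) :
    EuclideanSpace ℝ (Fin n) →L[ℝ] EuclideanSpace ℝ (Fin n) →L[ℝ] ℝ :=
  let D : EuclideanSpace ℝ (Fin n) →L[ℝ] EuclideanSpace ℝ (Fin n) :=
    mfderiv (𝓡 n) (𝓡 n) e.symm q
  let B : EuclideanSpace ℝ (Fin n) →L[ℝ] EuclideanSpace ℝ (Fin n) →L[ℝ] ℝ := g.inner (e.symm q)
  B.bilinearComp D D

lemma contDiffOn_coordMetric (g : SmoothMetric n M) (he : IsSmoothPartialDiffeo n e) :
    ContDiffOn ℝ ∞ (coordMetric g e) e.target := by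
  refine contDiffOn_clm_apply.2 fun v => contDiffOn_clm_apply.2 fun w => ?_
  rw [← contMDiffOn_iff_contDiffOn]
  have hg := g.contMDiff.comp_contMDiffOn he.contMDiffOn_symm
  have := ContMDiffOn.clm_bundle_apply₂ (F₃ := ℝ) (E₃ := Trivial M ℝ) hg
    (contMDiffOn_symm_coordVectorField he v)
    (contMDiffOn_symm_coordVectorField he w)
  intro q hq
  exact (contMDiffWithinAt_totalSpace.1 (this q hq)).2

lemma isInvertible_coordMetric (g : SmoothMetric n M) (he : IsSmoothPartialDiffeo n e)
    {q : EuclideanSpace ℝ (Fin n)} (hq : q ∈ e.target) : (coordMetric g e q).IsInvertible := by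
  have inj : Function.Injective (coordMetric g e q).toLinearMap := by
    rw [← LinearMap.ker_eq_bot, LinearMap.ker_eq_bot']
    intro v hv
    by_contra hne
    have hD : mfderiv (𝓡 n) (𝓡 n) e.symm q v ≠ 0 := by
      intro h0
      apply hne
      exact he.symm.mdifferentiable.mfderiv_injective (show q ∈ e.symm.source from hq)
        (h0.trans (map_zero _).symm)
    have h := g.pos (e.symm q) _ hD
    exact h.ne' (congrArg (fun L : EuclideanSpace ℝ (Fin n) →L[ℝ] ℝ => L v) hv)
  have hfr : Module.finrank ℝ (EuclideanSpace ℝ (Fin n))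
      = Module.finrank ℝ (EuclideanSpace ℝ (Fin n) →L[ℝ] ℝ) := by
    rw [← (LinearMap.toContinuousLinearMap (𝕜 := ℝ) (E := EuclideanSpace ℝ (Fin n))
      (F' := ℝ)).finrank_eq]
    exact (Subspace.dual_finrank_eq).symm
  exact ⟨(LinearEquiv.ofInjectiveOfFinrankEq (coordMetric g e q).toLinearMap inj
    hfr).toContinuousLinearEquiv, by ext; rfl⟩

/-- The dual metric in canonical coordinates, `|ξ|² = g^{ab} p_a p_b` with the inverse of the matrix
`g_{ab}`. -/
lemma conormSq_ofCanonicalCoord (g : SmoothMetric n M) (he : IsSmoothPartialDiffeo n e)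
    {q : EuclideanSpace ℝ (Fin n)} (hq : q ∈ e.target) (p : EuclideanSpace ℝ (Fin n)) :
    conormSq g (ofCanonicalCoord e (q, p))
      = innerSL ℝ p ((coordMetric g e q).inverse (innerSL ℝ p)) := by
  set w := (coordMetric g e q).inverse (innerSL ℝ p) with hw
  have hBw : coordMetric g e q w = innerSL ℝ p :=
    (isInvertible_coordMetric g he hq).self_apply_inverse _
  have hs := e.map_target hq
  have hright : ∀ v, mfderiv (𝓡 n) (𝓡 n) e (e.symm q) (mfderiv (𝓡 n) (𝓡 n) e.symm q v) = v :=
    fun v => he.symm.mfderiv_symm_comp (show q ∈ e.symm.source from hq) v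
  have hleft : ∀ u : TangentSpace (𝓡 n) (e.symm q),
      mfderiv (𝓡 n) (𝓡 n) e.symm q (mfderiv (𝓡 n) (𝓡 n) e (e.symm q) u) = u := by
    intro u
    obtain ⟨v, rfl⟩ := he.symm.mdifferentiable.mfderiv_surjective
      (show q ∈ e.symm.source from hq) u
    exact congrArg (mfderiv (𝓡 n) (𝓡 n) e.symm q) (hright v)
  have key : (flat g (e.symm q)).symm (ofCanonicalCoord e (q, p)).2
      = mfderiv (𝓡 n) (𝓡 n) e.symm q w := by
    refine (LinearEquiv.symm_apply_eq (flat g (e.symm q))).2 ?_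
    ext u
    have := DFunLike.congr_fun hBw (mfderiv (𝓡 n) (𝓡 n) e (e.symm q) u)
    refine this.symm.trans ?_
    exact congrArg (g.inner (e.symm q) (mfderiv (𝓡 n) (𝓡 n) e.symm q w)) (hleft u)
  have h1 : conormSq g (ofCanonicalCoord e (q, p)) = (ofCanonicalCoord e (q, p)).2
    ((flat g (e.symm q)).symm (ofCanonicalCoord e (q, p)).2) := rfl
  rw [h1, key]
  exact congrArg (innerSL ℝ p) (hright w)

lemma contDiffOn_coordHamiltonian (g : SmoothMetric n M) (he : IsSmoothPartialDiffeo n e) :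
    ContDiffOn ℝ ∞ (fun z : EuclideanSpace ℝ (Fin n) × EuclideanSpace ℝ (Fin n) =>
      coordHamiltonian g e z.1 z.2) (e.target ×ˢ univ) := by
  have hB : ContDiffOn ℝ ∞ (fun z : EuclideanSpace ℝ (Fin n) × EuclideanSpace ℝ (Fin n) =>
      coordMetric g e z.1) (e.target ×ˢ univ) :=
    (contDiffOn_coordMetric g he).comp contDiffOn_fst fun z hz => hz.1
  have hp : ContDiffOn ℝ ∞ (fun z : EuclideanSpace ℝ (Fin n) × EuclideanSpace ℝ (Fin n) =>
      innerSL ℝ z.2) (e.target ×ˢ univ) := ((innerSL ℝ).contDiff.comp contDiff_snd).contDiffOn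
  have hw := hB.clm_inverse_apply (fun z hz => isInvertible_coordMetric g he hz.1) hp
  refine ((hp.clm_apply hw).div_const 2).congr fun z hz => ?_
  simp only [coordHamiltonian, hamiltonian]
  rw [conormSq_ofCanonicalCoord g he hz.1]

lemma continuous_conormSq (g : SmoothMetric n M) : Continuous (conormSq g) := by
  refine continuous_iff_continuousAt.2 fun ζ => ?_
  set e := chartAt (EuclideanSpace ℝ (Fin n)) ζ.proj
  have he : IsSmoothPartialDiffeo n e := .chartAt _
  have hs : ζ.proj ∈ e.source := mem_chart_source _ _
  have hU : TotalSpace.proj ⁻¹' e.source ∈ 𝓝 ζ :=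
    (FiberBundle.continuous_proj _ _).continuousAt.preimage_mem_nhds (e.open_source.mem_nhds hs)
  have h1 := ((contMDiffOn_canonicalCoord he).contMDiffAt hU).continuousAt
  have h2 := (((contDiffOn_coordHamiltonian g he).continuousOn).continuousAt
    (x := canonicalCoord e ζ) ((e.open_target.prod isOpen_univ).mem_nhds
      ⟨e.map_source hs, mem_univ _⟩)).comp h1
  refine (h2.const_mul 2).congr ?_
  filter_upwards [hU] with η hη
  change 2 * (conormSq g (ofCanonicalCoord e (canonicalCoord e η)) / 2) = _
  rw [ofCanonicalCoord_canonicalCoord he hη]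
  ring

end SmoothCoordinates

/-! ### Orbits of the Hamiltonian flow -/

section HamiltonianOrbits

variable {n : ℕ} {M : Type*} [TopologicalSpace M]
  [ChartedSpace (EuclideanSpace ℝ (Fin n)) M] [IsManifold (𝓡 n) ∞ M]
  {N : Type*} [TopologicalSpace N]
  [ChartedSpace (EuclideanSpace ℝ (Fin n)) N] [IsManifold (𝓡 n) ∞ N]

lemma continuousOn_canonicalCoord {e : OpenPartialHomeomorph M (EuclideanSpace ℝ (Fin n))}
    (he : IsSmoothPartialDiffeo n e) :
    ContinuousOn (canonicalCoord e) (TotalSpace.proj ⁻¹' e.source) :=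
  (contMDiffOn_canonicalCoord he).continuousOn

lemma continuous_cotangentProj :
    Continuous (TotalSpace.proj : CotangentBundle n M → M) :=
  FiberBundle.continuous_proj _ _

lemma cotangentBundle_t2Space [T2Space M] : T2Space (CotangentBundle n M) := by
  refine ⟨fun ζ ζ' hne => ?_⟩
  by_cases h : ζ.proj = ζ'.proj
  · set e := chartAt (EuclideanSpace ℝ (Fin n)) ζ.proj
    have he : IsSmoothPartialDiffeo n e := .chartAt _
    have hs : ζ.proj ∈ e.source := mem_chart_source _ _
    have hs' : ζ'.proj ∈ e.source := h ▸ hs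
    have hc : canonicalCoord e ζ ≠ canonicalCoord e ζ' :=
      fun hc => hne (canonicalCoord_injOn he hs hs' hc)
    obtain ⟨U, V, hU, hV, hζU, hζV, hUV⟩ := t2_separation hc
    have hO : IsOpen (TotalSpace.proj ⁻¹' e.source : Set (CotangentBundle n M)) :=
      e.open_source.preimage continuous_cotangentProj
    refine ⟨_, _, (continuousOn_canonicalCoord he).isOpen_inter_preimage hO hU,
      (continuousOn_canonicalCoord he).isOpen_inter_preimage hO hV, ⟨hs, hζU⟩, ⟨hs', hζV⟩, ?_⟩
    exact (hUV.preimage _).mono inter_subset_right inter_subset_right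
  · exact separated_by_continuous continuous_cotangentProj h

/-- The Hamiltonian vector field `(∂H/∂p, -∂H/∂q)` in canonical coordinates. -/
def coordHamiltonianField (g : SmoothMetric n M)
    (e : OpenPartialHomeomorph M (EuclideanSpace ℝ (Fin n)))
    (z : EuclideanSpace ℝ (Fin n) × EuclideanSpace ℝ (Fin n)) :
    EuclideanSpace ℝ (Fin n) × EuclideanSpace ℝ (Fin n) :=
  (gradient (fun p => coordHamiltonian g e z.1 p) z.2,
    -gradient (fun q => coordHamiltonian g e q z.2) z.1)

lemma contDiffOn_coordHamiltonianField (g : SmoothMetric n M)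
    {e : OpenPartialHomeomorph M (EuclideanSpace ℝ (Fin n))} (he : IsSmoothPartialDiffeo n e) :
    ContDiffOn ℝ 1 (coordHamiltonianField g e) (e.target ×ˢ univ) := by
  set H : EuclideanSpace ℝ (Fin n) × EuclideanSpace ℝ (Fin n) → ℝ :=
    fun z => coordHamiltonian g e z.1 z.2 with hH
  have hopen : IsOpen (e.target ×ˢ (univ : Set (EuclideanSpace ℝ (Fin n)))) :=
    e.open_target.prod isOpen_univ
  have hsm : ContDiffOn ℝ ∞ H (e.target ×ˢ univ) := contDiffOn_coordHamiltonian g he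
  have hD : ContDiffOn ℝ 1 (fderiv ℝ H) (e.target ×ˢ univ) :=
    hsm.fderiv_of_isOpen hopen (by norm_cast)
  have key : ∀ z ∈ e.target ×ˢ (univ : Set (EuclideanSpace ℝ (Fin n))),
      coordHamiltonianField g e z =
      ((InnerProductSpace.toDual ℝ (EuclideanSpace ℝ (Fin n))).symm
        ((fderiv ℝ H z).comp (ContinuousLinearMap.inr ℝ _ _)),
      -(InnerProductSpace.toDual ℝ (EuclideanSpace ℝ (Fin n))).symm
        ((fderiv ℝ H z).comp (ContinuousLinearMap.inl ℝ _ _))) := by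
    intro z hz
    have hd : HasFDerivAt H (fderiv ℝ H z) (z.1, z.2) :=
      ((hsm.contDiffAt (hopen.mem_nhds hz)).differentiableAt (by simp)).hasFDerivAt
    have h1 := hd.comp z.2 (hasFDerivAt_prodMk_right z.1 z.2)
    have h2 := HasFDerivAt.comp (f := fun q => (q, z.2)) z.1 hd (hasFDerivAt_prodMk_left z.1 z.2)
    rw [← h1.fderiv, ← h2.fderiv]
    rfl
  refine ContDiffOn.congr ?_ key
  refine ContDiffOn.prodMk ?_ (ContDiffOn.neg ?_)
  · exact (InnerProductSpace.toDual ℝ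
      (EuclideanSpace ℝ (Fin n))).symm.toContinuousLinearEquiv.contDiff.comp_contDiffOn
      (hD.clm_comp contDiffOn_const)
  · exact (InnerProductSpace.toDual ℝ
      (EuclideanSpace ℝ (Fin n))).symm.toContinuousLinearEquiv.contDiff.comp_contDiffOn
      (hD.clm_comp contDiffOn_const)

lemma IsHamiltonianOrbit.hasDerivAt {g : SmoothMetric n M} {γ : ℝ → CosphereBundle g}
    (hγ : IsHamiltonianOrbit g γ) {e : OpenPartialHomeomorph M (EuclideanSpace ℝ (Fin n))}
    (he : IsSmoothPartialDiffeo n e) {t : ℝ} (ht : (γ t).1.proj ∈ e.source) :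
    HasDerivAt (fun s => canonicalCoord e (γ s).1)
      (coordHamiltonianField g e (canonicalCoord e (γ t).1)) t :=
  have h := hγ.2 e he.mem_maximalAtlas t ht
  h.1.prodMk h.2

lemma IsHamiltonianOrbit.of_hasDerivAt {g : SmoothMetric n M} {γ : ℝ → CosphereBundle g}
    (hc : Continuous γ)
    (h : ∀ e, IsSmoothPartialDiffeo n e → ∀ t : ℝ, (γ t).1.proj ∈ e.source →
      HasDerivAt (fun s => canonicalCoord e (γ s).1)
      (coordHamiltonianField g e (canonicalCoord e (γ t).1)) t) : IsHamiltonianOrbit g γ :=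
  ⟨hc, fun e he t ht =>
    have h := h e (.of_mem_maximalAtlas he) t ht
    ⟨(ContinuousLinearMap.fst ℝ (EuclideanSpace ℝ (Fin n))
        (EuclideanSpace ℝ (Fin n))).hasFDerivAt.comp_hasDerivAt t h,
      (ContinuousLinearMap.snd ℝ (EuclideanSpace ℝ (Fin n))
        (EuclideanSpace ℝ (Fin n))).hasFDerivAt.comp_hasDerivAt t h⟩⟩

/-- Uniqueness of orbits: the set of times at which two orbits agree is closed because `T^*M` is
Hausdorff, and open by the uniqueness theorem for ordinary differential equations in a chart. -/
lemma IsHamiltonianOrbit.eq_of_eq_zero [T2Space M] {g : SmoothMetric n M}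
    {γ γ' : ℝ → CosphereBundle g} (hγ : IsHamiltonianOrbit g γ) (hγ' : IsHamiltonianOrbit g γ')
    (h0 : γ 0 = γ' 0) : γ = γ' := by
  have := cotangentBundle_t2Space (n := n) (M := M)
  have hclosed : IsClosed {t | γ t = γ' t} := isClosed_eq hγ.1 hγ'.1
  have hopen : IsOpen {t | γ t = γ' t} := by
    refine isOpen_iff_mem_nhds.2 fun t₀ ht₀ => ?_
    have ht₀ : γ t₀ = γ' t₀ := ht₀
    set e := chartAt (EuclideanSpace ℝ (Fin n)) (γ t₀).1.proj
    have he : IsSmoothPartialDiffeo n e := .chartAt _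
    have hs : (γ t₀).1.proj ∈ e.source := mem_chart_source _ _
    have hbase : ∀ {δ : ℝ → CosphereBundle g}, IsHamiltonianOrbit g δ → δ t₀ = γ t₀ →
        ∀ᶠ t in 𝓝 t₀, (δ t).1.proj ∈ e.source := by
      intro δ hδ h
      refine (continuous_cotangentProj.comp
        (continuous_subtype_val.comp hδ.1)).continuousAt.eventually_mem
        (e.open_source.mem_nhds ?_)
      simpa [h] using hs
    obtain ⟨K, s, hsn, hLip⟩ := ((contDiffOn_coordHamiltonianField g he).contDiffAt
      (x := canonicalCoord e (γ t₀).1) ((e.open_target.prod isOpen_univ).mem_nhds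
      ⟨e.map_source hs, mem_univ _⟩)).exists_lipschitzOnWith
    have hev : ∀ {δ : ℝ → CosphereBundle g}, IsHamiltonianOrbit g δ → δ t₀ = γ t₀ →
        ∀ᶠ t in 𝓝 t₀, HasDerivAt (fun s => canonicalCoord e (δ s).1)
          (coordHamiltonianField g e (canonicalCoord e (δ t).1)) t ∧
          canonicalCoord e (δ t).1 ∈ s := by
      intro δ hδ h
      have hc : ContinuousAt (fun s => canonicalCoord e (δ s).1) t₀ :=
        (hδ.hasDerivAt he (by simpa [h] using hs)).continuousAt
      filter_upwards [hbase hδ h, hc.eventually_mem (by simpa [h] using hsn)] with t ht ht'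
      exact ⟨hδ.hasDerivAt he ht, ht'⟩
    have huniq := ODE_solution_unique_of_eventually
      (v := fun _ => coordHamiltonianField g e) (s := fun _ => s)
      (Eventually.of_forall fun _ => hLip)
      (hev hγ rfl) (hev hγ' ht₀.symm) (by simp only [ht₀])
    filter_upwards [huniq, hbase hγ rfl, hbase hγ' ht₀.symm] with t h1 h2 h3
    exact Subtype.ext (canonicalCoord_injOn he h2 h3 h1)
  have huniv := IsClopen.eq_univ ⟨hclosed, hopen⟩ ⟨0, h0⟩
  funext t
  exact (Set.ext_iff.1 huniv t).2 (mem_univ t)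

lemma hamiltonianFlow_eq [T2Space M] {g : SmoothMetric n M} {γ : ℝ → CosphereBundle g}
    (hγ : IsHamiltonianOrbit g γ) (t : ℝ) : hamiltonianFlow g t (γ 0) = γ t := by
  have h : ∃ δ : ℝ → CosphereBundle g, IsHamiltonianOrbit g δ ∧ δ 0 = γ 0 := ⟨γ, hγ, rfl⟩
  rw [hamiltonianFlow, dif_pos h, h.choose_spec.1.eq_of_eq_zero hγ h.choose_spec.2]

/-! ### Local isometries and the Hamiltonian flow -/

/-- A smooth partial diffeomorphism that preserves the dual metrics also preserves the Hamiltonian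
vector field, because it is the identity in corresponding canonical coordinates. -/
lemma coordHamiltonianField_trans {g : SmoothMetric n M} {g' : SmoothMetric n N}
    {P : OpenPartialHomeomorph M N} (hP : IsSmoothPartialDiffeo n P)
    (hiso : ∀ ζ : CotangentBundle n M, ζ.proj ∈ P.source →
      conormSq g' (cotangentLift P ζ) = conormSq g ζ)
    {e : OpenPartialHomeomorph N (EuclideanSpace ℝ (Fin n))} (he : IsSmoothPartialDiffeo n e)
    {z : EuclideanSpace ℝ (Fin n) × EuclideanSpace ℝ (Fin n)}
    (hz : z.1 ∈ (P.trans e).target) :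
    coordHamiltonianField g (P.trans e) z = coordHamiltonianField g' e z := by
  have hH : ∀ q ∈ (P.trans e).target, ∀ p,
      coordHamiltonian g (P.trans e) q p = coordHamiltonian g' e q p := by
    intro q hq p
    have hs := (P.trans e).map_target hq
    simp only [mfld_simps] at hs
    simp only [coordHamiltonian, hamiltonian]
    rw [← cotangentLift_ofCanonicalCoord hP he (z := (q, p)) hq, hiso]
    exact hs.1
  have h1 : (fun p => coordHamiltonian g (P.trans e) z.1 p)
      = fun p => coordHamiltonian g' e z.1 p := funext (hH z.1 hz)
  have h2 : (fun q => coordHamiltonian g (P.trans e) q z.2)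
      =ᶠ[𝓝 z.1] fun q => coordHamiltonian g' e q z.2 := by
    filter_upwards [(P.trans e).open_target.mem_nhds hz] with q hq using hH q hq z.2
  simp only [coordHamiltonianField]
  rw [h1, gradient, gradient, gradient, h2.fderiv_eq]

lemma hasDerivAt_canonicalCoord_cotangentLift {g : SmoothMetric n M} {g' : SmoothMetric n N}
    {P : OpenPartialHomeomorph M N} (hP : IsSmoothPartialDiffeo n P)
    (hiso : ∀ ζ : CotangentBundle n M, ζ.proj ∈ P.source →
      conormSq g' (cotangentLift P ζ) = conormSq g ζ)
    {e : OpenPartialHomeomorph N (EuclideanSpace ℝ (Fin n))} (he : IsSmoothPartialDiffeo n e)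
    {c : ℝ → CotangentBundle n M} {c' : ℝ → CotangentBundle n N} {t : ℝ}
    (hc : ContinuousAt (fun s => (c s).proj) t)
    (hcc' : ∀ᶠ s in 𝓝 t, c' s = cotangentLift P (c s))
    (ht : (c t).proj ∈ (P.trans e).source)
    (h : HasDerivAt (fun s => canonicalCoord (P.trans e) (c s))
      (coordHamiltonianField g (P.trans e) (canonicalCoord (P.trans e) (c t))) t) :
    HasDerivAt (fun s => canonicalCoord e (c' s))
      (coordHamiltonianField g' e (canonicalCoord e (c' t))) t := by
  rw [coordHamiltonianField_trans hP hiso he ((P.trans e).map_source ht)] at h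
  rw [hcc'.self_of_nhds, canonicalCoord_cotangentLift hP he ht]
  refine h.congr_of_eventuallyEq ?_
  filter_upwards [hcc', hc.eventually_mem ((P.trans e).open_source.mem_nhds ht)] with s hs hs'
  rw [hs, canonicalCoord_cotangentLift hP he hs']

end HamiltonianOrbits

/-! ### Riemannian coverings and the Hamiltonian flow -/

section LocalIsometries

variable {n : ℕ} {M : Type*} [TopologicalSpace M]
  [ChartedSpace (EuclideanSpace ℝ (Fin n)) M] [IsManifold (𝓡 n) ∞ M]
  {N : Type*} [TopologicalSpace N]
  [ChartedSpace (EuclideanSpace ℝ (Fin n)) N] [IsManifold (𝓡 n) ∞ N]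
  {g : SmoothMetric n M} {g' : SmoothMetric n N} {f : M → N}

/-- Near a given point, a local diffeomorphism `f` coincides with a smooth partial
diffeomorphism `P`, and the cotangent lifts of `f` and `P` coincide as well. -/
lemma IsLocalDiffeomorph.exists_partialDiffeo (hf : IsLocalDiffeomorph (𝓡 n) (𝓡 n) ∞ f) (x : M) :
    ∃ P : OpenPartialHomeomorph M N, IsSmoothPartialDiffeo n P ∧ x ∈ P.source ∧
      EqOn f P P.source ∧ ∀ ζ : CotangentBundle n M, ζ.proj ∈ P.source →
        cotangentLift f ζ = cotangentLift P ζ := by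
  obtain ⟨P, hP, hx, hfP⟩ := IsSmoothPartialDiffeo.of_isLocalDiffeomorphAt (hf x)
  exact ⟨P, hP, hx, hfP, fun ζ hζ =>
    cotangentLift_congr (hfP.eventuallyEq_of_mem (P.open_source.mem_nhds hζ))⟩

lemma cotangentLift_symm_cotangentLift {P : OpenPartialHomeomorph M N}
    (hP : IsSmoothPartialDiffeo n P) {ζ : CotangentBundle n N} (hζ : ζ.proj ∈ P.target) :
    cotangentLift P (cotangentLift P.symm ζ) = ζ := by
  have := hP.symm.cotangentLift_symm (ζ := ζ) hζ
  rwa [P.symm_symm] at this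

/-- The lift of a local diffeomorphism is bijective between the cotangent spaces at `x`
and `f x`. -/
lemma existsUnique_cotangentLift_eq (hf : IsLocalDiffeomorph (𝓡 n) (𝓡 n) ∞ f) (x : M)
    (ζ : CotangentBundle n N) (hζ : ζ.proj = f x) :
    ∃! η : CotangentBundle n M, η.proj = x ∧ cotangentLift f η = ζ := by
  obtain ⟨P, hP, hx, hfP, hlift⟩ := hf.exists_partialDiffeo x
  have hPx : P x = f x := (hfP hx).symm
  have hproj : (cotangentLift P.symm ζ).proj = x := by
    change P.symm ζ.proj = x
    rw [hζ, ← hPx, P.left_inv hx]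
  refine ⟨cotangentLift P.symm ζ, ⟨hproj, ?_⟩, ?_⟩
  · rw [hlift _ (hproj ▸ hx)]
    exact cotangentLift_symm_cotangentLift hP (by rw [hζ, ← hPx]; exact P.map_source hx)
  · rintro η ⟨rfl, rfl⟩
    rw [hlift _ hx, hP.cotangentLift_symm hx]

lemma cotangentLift_injOn_fibre (hf : IsLocalDiffeomorph (𝓡 n) (𝓡 n) ∞ f)
    {ζ ζ' : CotangentBundle n M} (h : ζ.proj = ζ'.proj)
    (h' : cotangentLift f ζ = cotangentLift f ζ') : ζ = ζ' :=
  (existsUnique_cotangentLift_eq hf ζ.proj (cotangentLift f ζ) rfl).unique ⟨rfl, rfl⟩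
    ⟨h.symm, h'.symm⟩

lemma continuous_cotangentLift (hf : IsLocalDiffeomorph (𝓡 n) (𝓡 n) ∞ f) :
    Continuous (cotangentLift f : CotangentBundle n M → CotangentBundle n N) :=
  (contMDiff_cotangentLift hf).continuous

lemma continuous_cosphereLift (hf : IsRiemannianLocalIsometry g g' f) :
    Continuous (cosphereLift hf) :=
  ((continuous_cotangentLift hf.isLocalDiffeomorph).comp continuous_subtype_val).subtype_mk _

lemma IsHamiltonianOrbit.comp_cosphereLift (hf : IsRiemannianLocalIsometry g g' f)
    {γ : ℝ → CosphereBundle g} (hγ : IsHamiltonianOrbit g γ) :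
    IsHamiltonianOrbit g' (cosphereLift hf ∘ γ) := by
  refine .of_hasDerivAt ((continuous_cosphereLift hf).comp hγ.1) fun e he t ht => ?_
  obtain ⟨P, hP, hx, hfP, hlift⟩ := hf.isLocalDiffeomorph.exists_partialDiffeo (γ t).1.proj
  have hc : ContinuousAt (fun s => (γ s).1.proj) t :=
    (continuous_cotangentProj.comp (continuous_subtype_val.comp hγ.1)).continuousAt
  have hs : (γ t).1.proj ∈ (P.trans e).source := by
    have : P (γ t).1.proj ∈ e.source := hfP hx ▸ ht
    simpa only [mfld_simps] using ⟨hx, this⟩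
  refine hasDerivAt_canonicalCoord_cotangentLift hP (g := g) ?_ he hc ?_ hs
    (hγ.hasDerivAt (hP.trans he) hs)
  · intro ζ hζ
    rw [← hlift ζ hζ, conormSq_cotangentLift hf]
  · filter_upwards [hc.eventually_mem (P.open_source.mem_nhds hx)] with s hs
    exact hlift _ hs

lemma IsHamiltonianOrbit.of_comp_cosphereLift (hf : IsRiemannianLocalIsometry g g' f)
    {γ : ℝ → CosphereBundle g} (hcont : Continuous γ)
    (hγ : IsHamiltonianOrbit g' (cosphereLift hf ∘ γ)) : IsHamiltonianOrbit g γ := by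
  refine .of_hasDerivAt hcont fun e he t ht => ?_
  obtain ⟨P, hP, hx, hfP, hlift⟩ := hf.isLocalDiffeomorph.exists_partialDiffeo (γ t).1.proj
  have hc : ContinuousAt (fun s => (γ s).1.proj) t :=
    (continuous_cotangentProj.comp (continuous_subtype_val.comp hcont)).continuousAt
  have hc' : ContinuousAt (fun s => ((cosphereLift hf ∘ γ) s).1.proj) t :=
    (continuous_cotangentProj.comp (continuous_subtype_val.comp hγ.1)).continuousAt
  have hfx : ((cosphereLift hf ∘ γ) t).1.proj = P (γ t).1.proj := hfP hx
  have hs : ((cosphereLift hf ∘ γ) t).1.proj ∈ (P.symm.trans e).source := by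
    have h1 : P (γ t).1.proj ∈ P.target := P.map_source hx
    have h2 : P.symm (P (γ t).1.proj) ∈ e.source := by rwa [P.left_inv hx]
    rw [hfx]
    simpa only [mfld_simps] using ⟨h1, h2⟩
  refine hasDerivAt_canonicalCoord_cotangentLift hP.symm (g := g') ?_ he hc' ?_ hs
    (hγ.hasDerivAt (hP.symm.trans he) hs)
  · intro ζ hζ
    have hp : (cotangentLift P.symm ζ).proj ∈ P.source := P.map_target hζ
    rw [← conormSq_cotangentLift hf, hlift _ hp, cotangentLift_symm_cotangentLift hP hζ]
  · filter_upwards [hc.eventually_mem (P.open_source.mem_nhds hx)] with s hs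
    change _ = cotangentLift P.symm (cotangentLift f (γ s).1)
    rw [hlift _ hs, hP.cotangentLift_symm hs]

/-- Curves in the cosphere bundle lift through coverings: the base curve lifts, and the covectors
over the lifted curve are determined by those over the base curve. -/
lemma exists_lift_cosphereLift (hcov : IsCoveringMap f) (hf : IsRiemannianLocalIsometry g g' f)
    {γ : ℝ → CosphereBundle g'} (hγ : Continuous γ) {ζ : CosphereBundle g}
    (h0 : γ 0 = cosphereLift hf ζ) :
    ∃ δ : ℝ → CosphereBundle g, Continuous δ ∧ cosphereLift hf ∘ δ = γ ∧ δ 0 = ζ := by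
  have hbase : Continuous fun t => (γ t).1.proj :=
    continuous_cotangentProj.comp (continuous_subtype_val.comp hγ)
  obtain ⟨c, ⟨hc0, hc⟩, -⟩ := hcov.existsUnique_continuousMap_lifts ⟨_, hbase⟩ (0 : ℝ)
    ζ.1.proj (by simp only [ContinuousMap.coe_mk, h0]; rfl)
  have hc' : ∀ t, (γ t).1.proj = f (c t) := fun t => (congrFun hc t).symm
  choose η hη _ using fun t =>
    existsUnique_cotangentLift_eq hf.isLocalDiffeomorph (c t) (γ t).1 (hc' t)
  have hcontη : Continuous η := by
    refine continuous_iff_continuousAt.2 fun t => ?_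
    obtain ⟨P, hP, hx, hfP, hlift⟩ := hf.isLocalDiffeomorph.exists_partialDiffeo (c t)
    have hU : TotalSpace.proj ⁻¹' P.target ∈ 𝓝 (γ t).1 := by
      refine continuous_cotangentProj.continuousAt.preimage_mem_nhds
        (P.open_target.mem_nhds ?_)
      rw [hc', hfP hx]
      exact P.map_source hx
    have h1 := (hP.symm.contMDiffOn_cotangentLift.contMDiffAt hU).continuousAt
    have h2 : ContinuousAt (fun s => (γ s).1) t :=
      (continuous_subtype_val.comp hγ).continuousAt
    refine (ContinuousAt.comp (f := fun s => (γ s).1) h1 h2).congr ?_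
    filter_upwards [c.continuous.continuousAt.eventually_mem (P.open_source.mem_nhds hx)]
      with s hs
    rw [← (hη s).1] at hs
    rw [Function.comp, ← (hη s).2, hlift _ hs, hP.cotangentLift_symm hs]
  have hunit : ∀ t, conormSq g (η t) = 1 := fun t => by
    rw [← conormSq_cotangentLift hf, (hη t).2]
    exact (γ t).2
  refine ⟨fun t => ⟨η t, hunit t⟩, hcontη.subtype_mk _, ?_, ?_⟩
  · funext t
    exact Subtype.ext (hη t).2
  · refine Subtype.ext (cotangentLift_injOn_fibre hf.isLocalDiffeomorph
      ((hη 0).1.trans hc0) ((hη 0).2.trans ?_))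
    rw [h0]
    rfl

/-- Riemannian coverings intertwine the Hamiltonian flows. Since orbits can be pushed forward and
lifted, there is an orbit through `ζ` if and only if there is one through its image; completeness
of the flow plays no role. -/
lemma cosphereLift_hamiltonianFlow [T2Space M] [T2Space N] (hcov : IsCoveringMap f)
    (hf : IsRiemannianLocalIsometry g g' f) (t : ℝ) (ζ : CosphereBundle g) :
    cosphereLift hf (hamiltonianFlow g t ζ) = hamiltonianFlow g' t (cosphereLift hf ζ) := by
  by_cases h : ∃ γ : ℝ → CosphereBundle g, IsHamiltonianOrbit g γ ∧ γ 0 = ζ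
  · obtain ⟨γ, hγ, rfl⟩ := h
    rw [hamiltonianFlow_eq hγ]
    exact (hamiltonianFlow_eq (hγ.comp_cosphereLift hf) t).symm
  · have h' : ¬ ∃ γ : ℝ → CosphereBundle g',
        IsHamiltonianOrbit g' γ ∧ γ 0 = cosphereLift hf ζ := by
      rintro ⟨γ, hγ, hγ0⟩
      obtain ⟨δ, hδ, rfl, hδ0⟩ := exists_lift_cosphereLift hcov hf hγ.1 hγ0
      exact h ⟨δ, hγ.of_comp_cosphereLift hf hδ, hδ0⟩
    rw [hamiltonianFlow, dif_neg h, hamiltonianFlow, dif_neg h']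

end LocalIsometries

/-! ### The symplectic volume -/

section LiouvilleMeasure

variable {n : ℕ} {M : Type*} [TopologicalSpace M]
  [ChartedSpace (EuclideanSpace ℝ (Fin n)) M] [IsManifold (𝓡 n) ∞ M]
  {N : Type*} [TopologicalSpace N]
  [ChartedSpace (EuclideanSpace ℝ (Fin n)) N] [IsManifold (𝓡 n) ∞ N]

/-- The measure `dq dp` in the canonical coordinates of the chart `e`. -/
def chartVolume (e : OpenPartialHomeomorph M (EuclideanSpace ℝ (Fin n))) :
    Measure (CotangentBundle n M) :=
  ((volume : Measure (EuclideanSpace ℝ (Fin n) × EuclideanSpace ℝ (Fin n))).restrict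
    (e.target ×ˢ Set.univ)).map (ofCanonicalCoord e)

lemma chartVolume_apply {e : OpenPartialHomeomorph M (EuclideanSpace ℝ (Fin n))}
    (he : IsSmoothPartialDiffeo n e) {C : Set (CotangentBundle n M)} (hC : MeasurableSet C) :
    chartVolume e C = volume (ofCanonicalCoord e ⁻¹' C ∩ (e.target ×ˢ Set.univ)) := by
  have hm : MeasurableSet (e.target ×ˢ (univ : Set (EuclideanSpace ℝ (Fin n)))) :=
    e.open_target.measurableSet.prod MeasurableSet.univ
  rw [chartVolume, Measure.map_apply_of_aemeasurable
    ((contMDiffOn_ofCanonicalCoord he).continuousOn.aemeasurable hm) hC, Measure.restrict_apply' hm]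

lemma chartVolume_le_symplecticVolume {e : OpenPartialHomeomorph M (EuclideanSpace ℝ (Fin n))}
    (he : IsSmoothPartialDiffeo n e) : chartVolume e ≤ symplecticVolume n M :=
  le_iSup₂ (f := fun e (_ : e ∈ IsManifold.maximalAtlas (𝓡 n) ∞ M) => chartVolume e)
    e he.mem_maximalAtlas

lemma chartVolume_trans {P : OpenPartialHomeomorph M N}
    (hP : IsSmoothPartialDiffeo n P) {e : OpenPartialHomeomorph N (EuclideanSpace ℝ (Fin n))}
    (he : IsSmoothPartialDiffeo n e) {B : Set (CotangentBundle n N)} (hB : MeasurableSet B)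
    (hBP : B ⊆ TotalSpace.proj ⁻¹' P.target)
    (hB' : MeasurableSet (TotalSpace.proj ⁻¹' P.source ∩ cotangentLift P ⁻¹' B)) :
    chartVolume (P.trans e) (TotalSpace.proj ⁻¹' P.source ∩ cotangentLift P ⁻¹' B)
      = chartVolume e B := by
  rw [chartVolume_apply (hP.trans he) hB', chartVolume_apply he hB]
  congr 1
  ext ⟨q, p⟩
  have key : q ∈ (P.trans e).target → (cotangentLift P (ofCanonicalCoord (P.trans e) (q, p))
      = ofCanonicalCoord e (q, p)) ∧ (P.trans e).symm q ∈ (P.trans e).source :=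
    fun hq => ⟨cotangentLift_ofCanonicalCoord hP he (z := (q, p)) hq, (P.trans e).map_target hq⟩
  constructor
  · rintro ⟨⟨h1, h2⟩, h3, -⟩
    have h3 : q ∈ (P.trans e).target := h3
    have h2 : cotangentLift P (ofCanonicalCoord (P.trans e) (q, p)) ∈ B := h2
    rw [(key h3).1] at h2
    simp only [mfld_simps] at h3
    exact ⟨h2, h3.1, mem_univ _⟩
  · rintro ⟨h1, h2, -⟩
    have h1 : ofCanonicalCoord e (q, p) ∈ B := h1
    have h4 : e.symm q ∈ P.target := hBP h1
    have h3 : q ∈ (P.trans e).target := by simpa only [mfld_simps] using ⟨h2, h4⟩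
    have h5 := (key h3).2
    refine ⟨⟨?_, ?_⟩, h3, mem_univ _⟩
    · simp only [mfld_simps] at h5
      exact h5.1
    · change cotangentLift P (ofCanonicalCoord (P.trans e) (q, p)) ∈ B
      rwa [(key h3).1]

lemma measurableSet_cotangentLift_preimage {P : OpenPartialHomeomorph M N}
    (hP : IsSmoothPartialDiffeo n P) {B : Set (CotangentBundle n N)} (hB : MeasurableSet B) :
    MeasurableSet (TotalSpace.proj ⁻¹' P.source ∩ cotangentLift P ⁻¹' B) := by
  have hU : MeasurableSet (TotalSpace.proj ⁻¹' P.source : Set (CotangentBundle n M)) :=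
    (P.open_source.preimage continuous_cotangentProj).measurableSet
  have h1 := hP.contMDiffOn_cotangentLift.continuousOn.domRestrict.measurable hB
  have h2 := hU.subtype_image h1
  convert h2 using 1
  ext ζ
  simp [and_comm]

/-- One inequality of `symplecticVolume_preimage`; applied to `P.symm`, it also gives the other. -/
lemma symplecticVolume_le_preimage {P : OpenPartialHomeomorph M N}
    (hP : IsSmoothPartialDiffeo n P) {B : Set (CotangentBundle n N)} (hB : MeasurableSet B)
    (hBP : B ⊆ TotalSpace.proj ⁻¹' P.target) :
    symplecticVolume n N B
      ≤ symplecticVolume n M (TotalSpace.proj ⁻¹' P.source ∩ cotangentLift P ⁻¹' B) := by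
  have hU : MeasurableSet (TotalSpace.proj ⁻¹' P.source : Set (CotangentBundle n M)) :=
    (P.open_source.preimage continuous_cotangentProj).measurableSet
  have hV : MeasurableSet (TotalSpace.proj ⁻¹' P.target : Set (CotangentBundle n N)) :=
    (P.open_target.preimage continuous_cotangentProj).measurableSet
  have hae : AEMeasurable (cotangentLift P : CotangentBundle n M → CotangentBundle n N)
      ((symplecticVolume n M).restrict (TotalSpace.proj ⁻¹' P.source)) :=
    hP.contMDiffOn_cotangentLift.continuousOn.aemeasurable hU
  -- `κ` dominates `dq dp` in every chart, hence the supremum of these measures, and agrees on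
  -- `B` with the push-forward of the symplectic volume of `M`
  let κ : Measure (CotangentBundle n N) :=
    ((symplecticVolume n M).restrict (TotalSpace.proj ⁻¹' P.source)).map (cotangentLift P)
      + (symplecticVolume n N).restrict (TotalSpace.proj ⁻¹' P.target)ᶜ
  have hκ : ∀ C, MeasurableSet C → κ C =
      symplecticVolume n M (TotalSpace.proj ⁻¹' P.source ∩ cotangentLift P ⁻¹' C)
        + symplecticVolume n N (C ∩ (TotalSpace.proj ⁻¹' P.target)ᶜ) := by
    intro C hC
    rw [Measure.add_apply, Measure.map_apply_of_aemeasurable hae hC, Measure.restrict_apply' hU,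
      Measure.restrict_apply' hV.compl, inter_comm]
  have hle : symplecticVolume n N ≤ κ := by
    refine iSup₂_le fun e he => ?_
    replace he : IsSmoothPartialDiffeo n e := .of_mem_maximalAtlas he
    change chartVolume e ≤ κ
    refine Measure.le_iff.2 fun C hC => ?_
    rw [hκ C hC, ← measure_inter_add_sdiff C hV]
    refine add_le_add ?_ (chartVolume_le_symplecticVolume he _)
    rw [← chartVolume_trans hP he (hC.inter hV) inter_subset_right
      (measurableSet_cotangentLift_preimage hP (hC.inter hV))]
    refine (measure_mono ?_).trans (chartVolume_le_symplecticVolume (hP.trans he) _)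
    exact inter_subset_inter_right _ (preimage_mono inter_subset_left)
  refine (hle B).trans ?_
  rw [hκ B hB, (disjoint_compl_right_iff_subset.2 hBP).inter_eq, measure_empty, add_zero]

/-- Smooth partial diffeomorphisms preserve the symplectic volume. -/
lemma symplecticVolume_preimage {P : OpenPartialHomeomorph M N}
    (hP : IsSmoothPartialDiffeo n P) {B : Set (CotangentBundle n N)} (hB : MeasurableSet B)
    (hBP : B ⊆ TotalSpace.proj ⁻¹' P.target) :
    symplecticVolume n M (TotalSpace.proj ⁻¹' P.source ∩ cotangentLift P ⁻¹' B)
      = symplecticVolume n N B := by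
  refine le_antisymm ?_ (symplecticVolume_le_preimage hP hB hBP)
  refine (symplecticVolume_le_preimage hP.symm (measurableSet_cotangentLift_preimage hP hB)
    inter_subset_left).trans (measure_mono ?_)
  rintro ζ ⟨h1, h2, h3⟩
  have h1 : ζ.proj ∈ P.target := h1
  have h3 : cotangentLift P (cotangentLift P.symm ζ) ∈ B := h3
  rwa [cotangentLift_symm_cotangentLift hP h1] at h3

/-! ### Finite Riemannian quotients -/

lemma IsRiemannianLocalIsometry.contMDiff {g : SmoothMetric n M} {g' : SmoothMetric n N}
    {f : M → N} (hf : IsRiemannianLocalIsometry g g' f) : ContMDiff (𝓡 n) (𝓡 n) ∞ f :=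
  hf.isLocalDiffeomorph.contMDiff

section Quotient

variable {K : Type*} [Group K] [MulAction K M] {g : SmoothMetric n M} {g' : SmoothMetric n N}
  {f : M → N}

/-- The homeomorphism `x ↦ k • x`. -/
def smulHomeomorph (hK : ∀ k : K, IsRiemannianLocalIsometry g g (fun x : M => k • x)) (k : K) :
    M ≃ₜ M where
  toEquiv := MulAction.toPerm k
  continuous_toFun := (hK k).contMDiff.continuous
  continuous_invFun := (hK k⁻¹).contMDiff.continuous

lemma isSmoothPartialDiffeo_smul
    (hK : ∀ k : K, IsRiemannianLocalIsometry g g (fun x : M => k • x)) (k : K) :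
    IsSmoothPartialDiffeo n (smulHomeomorph hK k).toOpenPartialHomeomorph :=
  ⟨(hK k).contMDiff.contMDiffOn, (hK k⁻¹).contMDiff.contMDiffOn⟩

/-- The sheets over a small open set `V` are the translates of one of them. The symplectic volume
of the preimage of a subset of `T^*V` is counted once for every element of the group. -/
lemma symplecticVolume_preimage_quotient [Fintype K]
    (hK : ∀ k : K, IsRiemannianLocalIsometry g g (fun x : M => k • x))
    (hfree : ∀ (k : K) (x : M), k • x = x → k = 1)
    (hf : IsRiemannianQuotient K g g' f) {P : OpenPartialHomeomorph M N}
    (hP : IsSmoothPartialDiffeo n P) (hfP : EqOn f P P.source)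
    {B : Set (CotangentBundle n N)} (hB : MeasurableSet B)
    (hBP : B ⊆ TotalSpace.proj ⁻¹' P.target) :
    symplecticVolume n M (cotangentLift f ⁻¹' B) = Fintype.card K * symplecticVolume n N B := by
  let Q : K → OpenPartialHomeomorph M N := fun k =>
    (smulHomeomorph hK k).toOpenPartialHomeomorph.trans P
  have hQ : ∀ k, IsSmoothPartialDiffeo n (Q k) := fun k =>
    (isSmoothPartialDiffeo_smul hK k).trans hP
  have hQs : ∀ k x, x ∈ (Q k).source ↔ k • x ∈ P.source := by
    intro k x
    simp only [Q, mfld_simps]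
    rfl
  have hQt : ∀ k, (Q k).target = P.target := by
    intro k
    simp [Q]
  have hfQ : ∀ k, EqOn f (Q k) (Q k).source := by
    intro k x hx
    have h1 : f (k • x) = P (k • x) := hfP ((hQs k x).1 hx)
    exact ((hf.fibre_eq_orbit x (k • x)).2 ⟨k, rfl⟩).trans h1
  have hlift : ∀ k, TotalSpace.proj ⁻¹' (Q k).source ∩ cotangentLift f ⁻¹' B
      = TotalSpace.proj ⁻¹' (Q k).source ∩ cotangentLift (Q k) ⁻¹' B := by
    intro k
    ext ζ
    refine and_congr_right fun hζ => ?_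
    rw [mem_preimage, mem_preimage, cotangentLift_congr
      ((hfQ k).eventuallyEq_of_mem ((Q k).open_source.mem_nhds hζ))]
  have hunion : cotangentLift f ⁻¹' B
      = ⋃ k, TotalSpace.proj ⁻¹' (Q k).source ∩ cotangentLift f ⁻¹' B := by
    rw [← iUnion_inter]
    refine (inter_eq_right.2 fun ζ hζ => ?_).symm
    have h1 : f ζ.proj ∈ P.target := hBP hζ
    have h2 : f (P.symm (f ζ.proj)) = f ζ.proj := by
      rw [hfP (P.map_target h1), P.right_inv h1]
    obtain ⟨k, hk⟩ := (hf.fibre_eq_orbit _ _).1 h2.symm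
    exact mem_iUnion.2 ⟨k, (hQs k _).2 (hk ▸ P.map_target h1)⟩
  have hdisj : Pairwise (Function.onFun Disjoint fun k : K =>
      TotalSpace.proj ⁻¹' (Q k).source ∩ cotangentLift f ⁻¹' B) := by
    intro k l hkl
    refine disjoint_left.2 fun ζ h1 h2 => hkl ?_
    have hk := (hQs k _).1 h1.1
    have hl := (hQs l _).1 h2.1
    have heq : k • ζ.proj = l • ζ.proj := by
      refine P.injOn hk hl ?_
      rw [← hfP hk, ← hfP hl]
      exact ((hf.fibre_eq_orbit _ _).2 ⟨k, rfl⟩).symm.trans ((hf.fibre_eq_orbit _ _).2 ⟨l, rfl⟩)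
    have := hfree (l⁻¹ * k) ζ.proj (by rw [mul_smul, heq, inv_smul_smul])
    rw [inv_mul_eq_one] at this
    exact this.symm
  have hmeas : ∀ k : K, MeasurableSet
      (TotalSpace.proj ⁻¹' (Q k).source ∩ cotangentLift f ⁻¹' B) := fun k => by
    rw [hlift]
    exact measurableSet_cotangentLift_preimage (hQ k) hB
  rw [hunion, measure_iUnion hdisj hmeas, tsum_fintype]
  rw [Finset.sum_congr rfl fun k _ => by
    rw [hlift k, symplecticVolume_preimage (hQ k) hB (by rw [hQt]; exact hBP)]]
  simp

lemma map_symplecticVolume_quotient [CompactSpace N] [Fintype K]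
    (hK : ∀ k : K, IsRiemannianLocalIsometry g g (fun x : M => k • x))
    (hfree : ∀ (k : K) (x : M), k • x = x → k = 1)
    (hf : IsRiemannianQuotient K g g' f) :
    (symplecticVolume n M).map (cotangentLift f)
      = (Fintype.card K : ENNReal) • symplecticVolume n N := by
  have hmeas : Measurable (cotangentLift f : CotangentBundle n M → CotangentBundle n N) :=
    (continuous_cotangentLift hf.isLocalIsometry.isLocalDiffeomorph).measurable
  choose s hs using hf.surjective
  choose P hP hx hfP _ using fun y : N =>
    hf.isLocalIsometry.isLocalDiffeomorph.exists_partialDiffeo (s y)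
  have hmem : ∀ y, y ∈ (P y).target := fun y => by
    have := (P y).map_source (hx y)
    rwa [← hfP y (hx y), hs] at this
  obtain ⟨t, ht⟩ := isCompact_univ.elim_finite_subcover (fun y => (P y).target)
    (fun y => (P y).open_target) (fun y _ => mem_iUnion.2 ⟨y, hmem y⟩)
  refine (Measure.ext_iff_of_biUnion_eq_univ (S := (t : Set N))
    (s := fun y => (TotalSpace.proj ⁻¹' (P y).target : Set (CotangentBundle n N)))
    t.countable_toSet ?_).2 fun y _ => ?_
  · refine eq_univ_of_forall fun ζ => ?_
    obtain ⟨y, hy, hζ⟩ := mem_iUnion₂.1 (ht (mem_univ ζ.proj))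
    exact mem_iUnion₂.2 ⟨y, hy, hζ⟩
  · have hV : MeasurableSet (TotalSpace.proj ⁻¹' (P y).target : Set (CotangentBundle n N)) :=
      ((P y).open_target.preimage continuous_cotangentProj).measurableSet
    ext C hC
    rw [Measure.restrict_apply hC, Measure.restrict_apply hC, Measure.map_apply hmeas (hC.inter hV),
      symplecticVolume_preimage_quotient hK hfree hf (hP y) (hfP y) (hC.inter hV)
      inter_subset_right]
    rfl

end Quotient

/-! ### The Liouville measure of a quotient -/

lemma canonicalCoord_smul (e : OpenPartialHomeomorph M (EuclideanSpace ℝ (Fin n)))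
    (c : ℝ) (ζ : CotangentBundle n M) :
    canonicalCoord e ⟨ζ.proj, c • ζ.2⟩ = ((canonicalCoord e ζ).1, c • (canonicalCoord e ζ).2) :=
  rfl

lemma continuous_cotangentSMul {X : Type*} [TopologicalSpace X] {c : X → ℝ}
    {ζ : X → CotangentBundle n M} (hc : Continuous c) (hζ : Continuous ζ) :
    Continuous fun x => (⟨(ζ x).proj, c x • (ζ x).2⟩ : CotangentBundle n M) := by
  refine continuous_iff_continuousAt.2 fun x => ?_
  set e := chartAt (EuclideanSpace ℝ (Fin n)) (ζ x).proj
  have he : IsSmoothPartialDiffeo n e := .chartAt _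
  have hs : (ζ x).proj ∈ e.source := mem_chart_source _ _
  have hU : TotalSpace.proj ⁻¹' e.source ∈ 𝓝 (ζ x) :=
    continuous_cotangentProj.continuousAt.preimage_mem_nhds (e.open_source.mem_nhds hs)
  have h1 : ContinuousAt (fun y => canonicalCoord e (ζ y)) x :=
    ((continuousOn_canonicalCoord he).continuousAt hU).comp hζ.continuousAt
  have h2 : ContinuousAt (fun y => ((canonicalCoord e (ζ y)).1,
      c y • (canonicalCoord e (ζ y)).2)) x :=
    h1.fst.prodMk (hc.continuousAt.smul h1.snd)
  have h3 := (contMDiffOn_ofCanonicalCoord he).continuousOn.continuousAt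
    (x := ((canonicalCoord e (ζ x)).1, c x • (canonicalCoord e (ζ x)).2))
    ((e.open_target.prod isOpen_univ).mem_nhds ⟨e.map_source hs, mem_univ _⟩)
  refine (ContinuousAt.comp (f := fun y => ((canonicalCoord e (ζ y)).1,
      c y • (canonicalCoord e (ζ y)).2)) h3 h2).congr ?_
  filter_upwards [hζ.continuousAt.eventually_mem hU] with y hy
  rw [Function.comp, ← canonicalCoord_smul]
  exact ofCanonicalCoord_canonicalCoord he hy

lemma continuous_radialProjection (g : SmoothMetric n M) : Continuous (radialProjection g) := by
  refine (continuous_cotangentSMul (ζ := fun ζ : PuncturedCoball g => ζ.1)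
    (c := fun ζ => (Real.sqrt (conormSq g ζ.1))⁻¹) ?_ continuous_subtype_val).subtype_mk _
  refine Continuous.inv₀ (((continuous_conormSq g).comp continuous_subtype_val).sqrt) ?_
  exact fun ζ => (Real.sqrt_pos.2 ζ.2.1).ne'

/-- The truncated cone over a subset of `S^*M`. -/
def truncatedCone (g : SmoothMetric n M) (C : Set (CosphereBundle g)) :
    Set (CotangentBundle n M) :=
  Subtype.val '' (radialProjection g ⁻¹' C)

lemma measurableSet_puncturedCoball (g : SmoothMetric n M) :
    MeasurableSet {ζ : CotangentBundle n M | 0 < conormSq g ζ ∧ conormSq g ζ ≤ 1} :=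
  ((isOpen_lt continuous_const (continuous_conormSq g)).measurableSet).inter
    (isClosed_le (continuous_conormSq g) continuous_const).measurableSet

lemma measurableSet_truncatedCone (g : SmoothMetric n M) {C : Set (CosphereBundle g)}
    (hC : MeasurableSet C) : MeasurableSet (truncatedCone g C) :=
  (measurableSet_puncturedCoball g).subtype_image ((continuous_radialProjection g).measurable hC)

lemma coneMeasure_apply (g : SmoothMetric n M) {C : Set (CosphereBundle g)}
    (hC : MeasurableSet C) : coneMeasure g C = symplecticVolume n M (truncatedCone g C) := by
  rw [coneMeasure, Measure.map_apply (continuous_radialProjection g).measurable hC]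
  exact (MeasurableEmbedding.subtype_coe (measurableSet_puncturedCoball g)).comap_apply _ _

lemma preimage_truncatedCone {g : SmoothMetric n M} {g' : SmoothMetric n N} {f : M → N}
    (hf : IsRiemannianLocalIsometry g g' f) (C : Set (CosphereBundle g')) :
    cotangentLift f ⁻¹' truncatedCone g' C = truncatedCone g (cosphereLift hf ⁻¹' C) := by
  have key : ∀ (ζ : PuncturedCoball g) (h : 0 < conormSq g' (cotangentLift f ζ.1) ∧
      conormSq g' (cotangentLift f ζ.1) ≤ 1),
      radialProjection g' ⟨cotangentLift f ζ.1, h⟩ = cosphereLift hf (radialProjection g ζ) := by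
    intro ζ h
    refine Subtype.ext ?_
    simp only [radialProjection, cosphereLift, conormSq_cotangentLift hf]
    rfl
  ext ζ
  constructor
  · rintro ⟨⟨η, hη⟩, hC, rfl : η = cotangentLift f ζ⟩
    have hη' := hη
    rw [conormSq_cotangentLift hf] at hη'
    refine ⟨⟨ζ, hη'⟩, ?_, rfl⟩
    rw [mem_preimage, mem_preimage, ← key ⟨ζ, hη'⟩ hη]
    exact hC
  · rintro ⟨⟨ζ, hζ⟩, hC, rfl⟩
    have hζ' := hζ
    rw [← conormSq_cotangentLift hf] at hζ'
    refine ⟨⟨cotangentLift f ζ, hζ'⟩, ?_, rfl⟩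
    rw [mem_preimage, key ⟨ζ, hζ⟩ hζ']
    exact hC

section Quotient

variable [CompactSpace N] {K : Type*} [Group K] [Fintype K] [MulAction K M]
  {g : SmoothMetric n M} {g' : SmoothMetric n N} {f : M → N}

lemma map_coneMeasure_quotient
    (hK : ∀ k : K, IsRiemannianLocalIsometry g g (fun x : M => k • x))
    (hfree : ∀ (k : K) (x : M), k • x = x → k = 1)
    (hf : IsRiemannianQuotient K g g' f) :
    (coneMeasure g).map (cosphereLift hf.isLocalIsometry)
      = (Fintype.card K : ENNReal) • coneMeasure g' := by
  have hF : Measurable (cotangentLift f : CotangentBundle n M → CotangentBundle n N) :=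
    (continuous_cotangentLift hf.isLocalIsometry.isLocalDiffeomorph).measurable
  have hL : Measurable (cosphereLift hf.isLocalIsometry) :=
    (continuous_cosphereLift hf.isLocalIsometry).measurable
  ext C hC
  rw [Measure.map_apply hL hC, coneMeasure_apply g (hL hC), ← preimage_truncatedCone,
    ← Measure.map_apply hF (measurableSet_truncatedCone g' hC),
    map_symplecticVolume_quotient hK hfree hf, Measure.smul_apply, Measure.smul_apply,
    coneMeasure_apply g' hC]

/-- The normalization makes the number of sheets disappear. -/
lemma measurePreserving_cosphereLift
    (hK : ∀ k : K, IsRiemannianLocalIsometry g g (fun x : M => k • x))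
    (hfree : ∀ (k : K) (x : M), k • x = x → k = 1)
    (hf : IsRiemannianQuotient K g g' f) :
    MeasurePreserving (cosphereLift hf.isLocalIsometry) (liouvilleMeasure g)
      (liouvilleMeasure g') := by
  have hL : Measurable (cosphereLift hf.isLocalIsometry) :=
    (continuous_cosphereLift hf.isLocalIsometry).measurable
  refine ⟨hL, ?_⟩
  have hcone := map_coneMeasure_quotient hK hfree hf
  have huniv : coneMeasure g univ = Fintype.card K * coneMeasure g' univ := by
    have := congrArg (fun μ : Measure (CosphereBundle g') => μ univ) hcone
    simpa [Measure.map_apply hL MeasurableSet.univ] using this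
  have hcard : (Fintype.card K : ENNReal) ≠ 0 := by simp
  have htop : (Fintype.card K : ENNReal) ≠ ⊤ := ENNReal.natCast_ne_top _
  rw [liouvilleMeasure, liouvilleMeasure, Measure.map_smul, hcone, huniv, smul_smul,
    ENNReal.mul_inv (.inl hcard) (.inl htop), mul_right_comm,
    ENNReal.inv_mul_cancel hcard htop, one_mul]

end Quotient

end LiouvilleMeasure

/-! ### Kernels of unitary intertwining operators -/

section Kernels

variable {G : Type*} [Group G] [Fintype G] {H₁ H₂ : Subgroup G} {A : G → ℂ}

open Classical in
lemma sum_comp_quotientMk (H : Subgroup G) {E : Type*} [AddCommMonoid E] (F : G ⧸ H → E) :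
    ∑ a : G, F (a : G ⧸ H) = Nat.card H • ∑ q : G ⧸ H, F q := by
  rw [← Finset.sum_fiberwise (s := Finset.univ) (g := fun a : G => (a : G ⧸ H)), Finset.smul_sum]
  refine Finset.sum_congr rfl fun q _ => ?_
  rw [Finset.sum_congr rfl (g := fun _ => F q) (fun a ha => by rw [(Finset.mem_filter.1 ha).2]),
    Finset.sum_const]
  congr 1
  have := QuotientGroup.card_preimage_mk H {q}
  rw [Nat.card_unique (α := ({q} : Set (G ⧸ H))), mul_one] at this
  rw [← this, Nat.card_eq_fintype_card, ← Set.toFinset_card]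
  congr 1
  ext a
  simp

/-- The dimensions of `L²(G/H₁)` and `L²(G/H₂)` agree. -/
lemma UnitaryModuleEquiv.card_eq (T : UnitaryModuleEquiv H₁ H₂) : Nat.card H₁ = Nat.card H₂ := by
  classical
  have h := T.toEquiv.toLinearEquiv.finrank_eq
  rw [finrank_euclideanSpace, finrank_euclideanSpace, ← Nat.card_eq_fintype_card,
    ← Nat.card_eq_fintype_card] at h
  have h1 := H₁.card_eq_card_quotient_mul_card_subgroup
  have h2 := H₂.card_eq_card_quotient_mul_card_subgroup
  rw [h1, h] at h2
  exact Nat.eq_of_mul_eq_mul_left Nat.card_pos h2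

open Classical in
/-- The kernel of an intertwining operator is `A(a) = (T δ_{aH₁})(H₂) / #H₁`. -/
lemma exists_isUnitaryIntertwiningKernel (T : UnitaryModuleEquiv H₁ H₂) :
    ∃ A : G → ℂ, IsUnitaryIntertwiningKernel H₁ H₂ A := by
  let δ : G ⧸ H₁ → L2Coset H₁ := fun q => EuclideanSpace.single q 1
  have htrans : ∀ (a : G) (q : G ⧸ H₁), cosetTranslate H₁ a (δ q) = δ (a • q) := by
    intro a q
    ext r
    simp [cosetTranslate, δ, inv_smul_eq_iff]
  have hval : ∀ (a : G) (φ : L2Coset H₁) (q : G ⧸ H₂),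
      T.toEquiv (cosetTranslate H₁ a φ) q = T.toEquiv φ (a⁻¹ • q) := by
    intro a φ q
    rw [T.equivariant]
    rfl
  refine ⟨fun a => (Nat.card H₁ : ℂ)⁻¹ * T.toEquiv (δ a) ((1 : G) : G ⧸ H₂), ?_, T, ?_⟩
  · intro b₂ a b₁
    congr 1
    have h1 : δ ((b₂ * a * b₁ : G) : G ⧸ H₁) = cosetTranslate H₁ (b₂ : G) (δ (a : G ⧸ H₁)) := by
      rw [htrans]
      congr 1
      exact QuotientGroup.mk_mul_of_mem _ b₁.2
    rw [h1, hval]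
    exact congrArg _ (QuotientGroup.eq.2 (by simp : ((b₂ : G)⁻¹ * 1)⁻¹ * 1 ∈ H₂))
  · intro φ x
    have h1 : T.toEquiv φ (x : G ⧸ H₂)
        = T.toEquiv (cosetTranslate H₁ x⁻¹ φ) ((1 : G) : G ⧸ H₂) := by
      rw [hval, inv_inv]
      exact congrArg (fun a : G => T.toEquiv φ (a : G ⧸ H₂)) (mul_one x).symm
    have h2 : cosetTranslate H₁ x⁻¹ φ = ∑ q, φ (x • q) • δ q := by
      ext r
      simp [cosetTranslate, δ, Pi.single_apply]
    rw [h1, h2, map_sum]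
    have hcard : (Nat.card H₁ : ℂ) ≠ 0 := Nat.cast_ne_zero.2 Nat.card_pos.ne'
    have h3 := sum_comp_quotientMk H₁ (fun q => (Nat.card H₁ : ℂ)⁻¹ *
      T.toEquiv (δ q) ((1 : G) : G ⧸ H₂) * φ (x • q))
    refine Eq.trans ?_ h3.symm
    rw [nsmul_eq_mul, Finset.mul_sum, WithLp.ofLp_sum, Finset.sum_apply]
    refine Finset.sum_congr rfl fun q _ => ?_
    rw [map_smul]
    simp only [PiLp.smul_apply, smul_eq_mul]
    field_simp

/-- The kernel of the adjoint operator. -/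
def adjointKernel (A : G → ℂ) (a : G) : ℂ := starRingEnd ℂ (A a⁻¹)

lemma adjointKernel_biinvariant (hA : ∀ (b₂ : H₂) (a : G) (b₁ : H₁), A (b₂ * a * b₁) = A a)
    (b₁ : H₁) (a : G) (b₂ : H₂) : adjointKernel A (b₁ * a * b₂) = adjointKernel A a := by
  have := hA b₂⁻¹ a⁻¹ b₁⁻¹
  simp only [adjointKernel, mul_inv_rev, ← mul_assoc]
  rw [← this]
  rfl

open Classical in
/-- The inverse of a unitary operator is its adjoint, so that its matrix coefficients are
`(𝒜⁻¹ ψ)(yH₁) = ⟪𝒜 δ_{yH₁}, ψ⟫`. -/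
lemma symm_apply_of_kernel (hA : ∀ (b₂ : H₂) (a : G) (b₁ : H₁), A (b₂ * a * b₁) = A a)
    (T : UnitaryModuleEquiv H₁ H₂)
    (hT : ∀ (φ : L2Coset H₁) (x : G),
      T.toEquiv φ (x : G ⧸ H₂) = ∑ a : G, A a * φ ((x * a : G) : G ⧸ H₁))
    (ψ : L2Coset H₂) (y : G) :
    T.toEquiv.symm ψ (y : G ⧸ H₁)
      = ∑ a : G, adjointKernel A a * ψ ((y * a : G) : G ⧸ H₂) := by
  let δ : L2Coset H₁ := EuclideanSpace.single (y : G ⧸ H₁) 1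
  have hcard : (Nat.card H₂ : ℂ) ≠ 0 := Nat.cast_ne_zero.2 Nat.card_pos.ne'
  have hδ : ∀ x : G, T.toEquiv δ (x : G ⧸ H₂) = Nat.card H₁ * A (x⁻¹ * y) := by
    intro x
    rw [hT]
    let Ā : G ⧸ H₁ → ℂ := Quotient.lift A (by
      intro a b hab
      obtain ⟨h, rfl⟩ : ∃ h : H₁, a * h = b :=
        ⟨⟨a⁻¹ * b, QuotientGroup.leftRel_apply.1 hab⟩, by simp⟩
      simpa using (hA 1 a h).symm)
    have hĀ : ∀ a : G, Ā (a : G ⧸ H₁) = A a := fun a => rfl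
    have h1 := sum_comp_quotientMk H₁ (fun q => if q = ((x⁻¹ * y : G) : G ⧸ H₁) then Ā q else 0)
    rw [Finset.sum_ite_eq' Finset.univ, if_pos (Finset.mem_univ _), hĀ, nsmul_eq_mul] at h1
    rw [← h1]
    refine Finset.sum_congr rfl fun a _ => ?_
    have h2 : ((x * a : G) : G ⧸ H₁) = (y : G ⧸ H₁) ↔ (a : G ⧸ H₁) = ((x⁻¹ * y : G) : G ⧸ H₁) := by
      rw [QuotientGroup.eq, QuotientGroup.eq]
      simp [mul_assoc]
    simp only [δ, PiLp.single_apply, hĀ, h2, mul_ite, mul_one, mul_zero]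
  have h1 : T.toEquiv.symm ψ (y : G ⧸ H₁) = inner ℂ (T.toEquiv δ) ψ := by
    have h2 := T.toEquiv.inner_map_map δ (T.toEquiv.symm ψ)
    rw [T.toEquiv.apply_symm_apply] at h2
    rw [h2, EuclideanSpace.inner_single_left]
    simp
  have h2 := sum_comp_quotientMk H₂ (fun q => inner ℂ (T.toEquiv δ q) (ψ q))
  rw [← PiLp.inner_apply, ← h1, nsmul_eq_mul] at h2
  refine mul_left_cancel₀ hcard (h2.symm.trans ?_)
  rw [← Equiv.sum_comp (Equiv.mulLeft y), Finset.mul_sum]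
  refine Finset.sum_congr rfl fun a _ => ?_
  rw [Equiv.coe_mulLeft, hδ, T.card_eq, adjointKernel, RCLike.inner_apply, mul_inv_rev,
    inv_mul_cancel_right, map_mul, map_natCast]
  ring

open Classical in
lemma IsUnitaryIntertwiningKernel.adjoint (hA : IsUnitaryIntertwiningKernel H₁ H₂ A) :
    IsUnitaryIntertwiningKernel H₂ H₁ (adjointKernel A) := by
  obtain ⟨hbi, T, hT⟩ := hA
  refine ⟨adjointKernel_biinvariant hbi, ⟨T.toEquiv.symm, fun a φ => ?_⟩,
    fun ψ y => symm_apply_of_kernel hbi T hT ψ y⟩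
  rw [LinearIsometryEquiv.symm_apply_eq, T.equivariant, T.toEquiv.apply_symm_apply]

@[simp] lemma adjointKernel_adjointKernel (A : G → ℂ) : adjointKernel (adjointKernel A) = A := by
  funext a
  simp [adjointKernel]

end Kernels

/-! ### The Radon transform on orbit spaces -/

section OrbitRadon

variable {G : Type*} [Group G] [Fintype G] {H₁ H₂ : Subgroup G} {A : G → ℂ}
  {X X₁ X₂ : Type*} [MulAction G X] {π₁ : X → X₁} {π₂ : X → X₂}

/-- `p : X → X₁` is the quotient map of the set `X` by the action of the subgroup `H`. -/
structure IsOrbitMap (H : Subgroup G) (p : X → X₁) : Prop where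
  surjective : Function.Surjective p
  eq_iff : ∀ x y : X, p x = p y ↔ ∃ k : H, k • x = y

lemma IsOrbitMap.map_smul {H : Subgroup G} {p : X → X₁} (hp : IsOrbitMap H p) (k : H) (x : X) :
    p ((k : G) • x) = p x :=
  ((hp.eq_iff _ _).2 ⟨k, rfl⟩).symm

/-- The finite Radon transform from functions on `H₁ \ X` to functions on `H₂ \ X`, normalized
without the sum over the fibres of `π₂`: at `π₂ x` it is `∑ a, A a * f (π₁ (a⁻¹ • x))`, see
`orbitRadon_apply`. The definition evaluates this sum at a chosen point of the orbit. -/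
def orbitRadon (π₁ : X → X₁) (h₂ : IsOrbitMap H₂ π₂) (A : G → ℂ) (f : X₁ → ℂ) (y : X₂) : ℂ :=
  ∑ a, A a * f (π₁ (a⁻¹ • Function.surjInv h₂.surjective y))

lemma orbitRadon_apply (h₂ : IsOrbitMap H₂ π₂)
    (hA : ∀ (b₂ : H₂) (a : G), A (b₂ * a) = A a) (f : X₁ → ℂ) (x : X) :
    orbitRadon π₁ h₂ A f (π₂ x) = ∑ a, A a * f (π₁ (a⁻¹ • x)) := by
  obtain ⟨k, hk⟩ := (h₂.eq_iff x _).1 (Function.surjInv_eq h₂.surjective (π₂ x)).symm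
  rw [orbitRadon, ← hk, ← Equiv.sum_comp (Equiv.mulLeft (k : G))]
  refine Finset.sum_congr rfl fun a _ => ?_
  rw [Equiv.coe_mulLeft, hA, mul_inv_rev, mul_smul]
  change _ * f (π₁ (a⁻¹ • (k : G)⁻¹ • (k : G) • x)) = _
  rw [inv_smul_smul]

lemma fibreSum_orbitMap [Fintype H₂] (h₂ : IsOrbitMap H₂ π₂)
    (hfree : ∀ (a : G) (x : X), a • x = x → a = 1) (F : X → ℂ) (x : X) :
    fibreSum π₂ F (π₂ x) = ∑ k : H₂, F ((k : G) • x) := by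
  have hrange : π₂ ⁻¹' {π₂ x} = Set.range fun k : H₂ => (k : G) • x := by
    ext y
    exact eq_comm.trans (h₂.eq_iff x y)
  have hinj : Function.Injective fun k : H₂ => (k : G) • x := by
    intro k l hkl
    have hkl : (k : G) • x = (l : G) • x := hkl
    have := hfree ((l : G)⁻¹ * k) x (by rw [mul_smul, hkl, inv_smul_smul])
    rw [inv_mul_eq_one] at this
    exact Subtype.ext this.symm
  rw [fibreSum, hrange, finsum_mem_range hinj, finsum_eq_sum_of_fintype]

/-- Each of the `#H₂` points of a fibre of `π₂` contributes the same sum over `G`, and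
`#H₂ = #H₁`. -/
lemma orbitRadon_eq_fibreSum (h₂ : IsOrbitMap H₂ π₂)
    (hfree : ∀ (a : G) (x : X), a • x = x → a = 1) (hcard : Nat.card H₁ = Nat.card H₂)
    (hA : ∀ (b₂ : H₂) (a : G), A (b₂ * a) = A a) (f : X₁ → ℂ) (y : X₂) :
    1 / (Nat.card H₁ : ℂ) * ∑ a, A a * fibreSum π₂ (fun x => f (π₁ (a⁻¹ • x))) y
      = orbitRadon π₁ h₂ A f y := by
  classical
  obtain ⟨x, rfl⟩ := h₂.surjective y
  have hne : (Nat.card H₁ : ℂ) ≠ 0 := Nat.cast_ne_zero.2 Nat.card_pos.ne'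
  have hk : ∀ k : H₂, ∑ a, A a * f (π₁ (a⁻¹ • (k : G) • x)) = orbitRadon π₁ h₂ A f (π₂ x) := by
    intro k
    rw [← orbitRadon_apply h₂ hA, h₂.map_smul]
  simp only [fibreSum_orbitMap h₂ hfree, Finset.mul_sum (Finset.univ : Finset H₂)]
  rw [Finset.sum_comm, Finset.sum_congr rfl fun k _ => hk k, Finset.sum_const, Finset.card_univ,
    ← Nat.card_eq_fintype_card, ← hcard, nsmul_eq_mul]
  field_simp

/-- The restriction of a function on `H \ X` to the `G`-orbit of `x`, as a function on `G / H`: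
the coset `aH` corresponds to the point `H a⁻¹ x`. -/
def orbitRestrict (H : Subgroup G) (p : X → X₁) (f : X₁ → ℂ) (x : X) : L2Coset H :=
  WithLp.toLp 2 fun q => f (p (q.out⁻¹ • x))

lemma orbitRestrict_mk {H : Subgroup G} {p : X → X₁} (hp : IsOrbitMap H p) (f : X₁ → ℂ) (x : X)
    (a : G) : orbitRestrict H p f x (a : G ⧸ H) = f (p (a⁻¹ • x)) := by
  obtain ⟨k, hk⟩ := QuotientGroup.mk_out_eq_mul H a
  change f (p ((a : G ⧸ H).out⁻¹ • x)) = _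
  rw [hk, mul_inv_rev, mul_smul]
  exact congrArg f (hp.map_smul k⁻¹ _)

/-- On every `G`-orbit, the Radon transform is the intertwining operator
`L²(G/H₁) → L²(G/H₂)`. -/
lemma orbitRestrict_orbitRadon (h₁ : IsOrbitMap H₁ π₁) (h₂ : IsOrbitMap H₂ π₂)
    (hA : ∀ (b₂ : H₂) (a : G), A (b₂ * a) = A a) (T : UnitaryModuleEquiv H₁ H₂)
    (hT : ∀ (φ : L2Coset H₁) (x : G),
      T.toEquiv φ (x : G ⧸ H₂) = ∑ a : G, A a * φ ((x * a : G) : G ⧸ H₁))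
    (f : X₁ → ℂ) (x : X) :
    orbitRestrict H₂ π₂ (orbitRadon π₁ h₂ A f) x = T.toEquiv (orbitRestrict H₁ π₁ f x) := by
  ext q
  obtain ⟨y, rfl⟩ := QuotientGroup.mk_surjective q
  rw [orbitRestrict_mk h₂, orbitRadon_apply h₂ hA, hT]
  refine Finset.sum_congr rfl fun a _ => ?_
  rw [orbitRestrict_mk h₁, mul_inv_rev, mul_smul]

lemma IsUnitaryIntertwiningKernel.left_invariant (hA : IsUnitaryIntertwiningKernel H₁ H₂ A)
    (b₂ : H₂) (a : G) : A (b₂ * a) = A a := by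
  simpa using hA.biinvariant b₂ a 1

open Classical in
/-- The Radon transform with the adjoint kernel inverts the Radon transform. -/
lemma orbitRadon_adjointKernel_orbitRadon (h₁ : IsOrbitMap H₁ π₁) (h₂ : IsOrbitMap H₂ π₂)
    (hA : IsUnitaryIntertwiningKernel H₁ H₂ A) (f : X₁ → ℂ) :
    orbitRadon π₂ h₁ (adjointKernel A) (orbitRadon π₁ h₂ A f) = f := by
  obtain ⟨T, hT⟩ := hA.unitary
  have hA' := hA.adjoint
  let T' : UnitaryModuleEquiv H₂ H₁ := ⟨T.toEquiv.symm, fun a φ => by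
    rw [LinearIsometryEquiv.symm_apply_eq, T.equivariant, T.toEquiv.apply_symm_apply]⟩
  funext y
  obtain ⟨x, rfl⟩ := h₁.surjective y
  have h := orbitRestrict_orbitRadon h₂ h₁ hA'.left_invariant T'
    (symm_apply_of_kernel hA.biinvariant T hT) (orbitRadon π₁ h₂ A f) x
  rw [orbitRestrict_orbitRadon h₁ h₂ hA.left_invariant T hT] at h
  have h' := h.trans (T.toEquiv.symm_apply_apply _)
  have h'' := congrArg (fun φ : L2Coset H₁ => φ ((1 : G) : G ⧸ H₁)) h'
  simpa [orbitRestrict_mk h₁] using h''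

open Classical in
lemma sum_norm_sq_orbit {H : Subgroup G} {p : X → X₁} (hp : IsOrbitMap H p) (f : X₁ → ℂ) (x : X) :
    ∑ a : G, ‖f (p (a⁻¹ • x))‖ ^ 2 = Nat.card H * ‖orbitRestrict H p f x‖ ^ 2 := by
  rw [EuclideanSpace.norm_sq_eq, ← nsmul_eq_mul, ← sum_comp_quotientMk]
  simp only [orbitRestrict_mk hp]

/-- The unitarity of the intertwining operator, summed over a `G`-orbit. -/
lemma sum_enorm_orbitRadon (h₁ : IsOrbitMap H₁ π₁) (h₂ : IsOrbitMap H₂ π₂)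
    (hA : IsUnitaryIntertwiningKernel H₁ H₂ A) (f : X₁ → ℂ) (x : X) :
    ∑ a : G, ‖orbitRadon π₁ h₂ A f (π₂ (a⁻¹ • x))‖ₑ ^ 2 = ∑ a : G, ‖f (π₁ (a⁻¹ • x))‖ₑ ^ 2 := by
  classical
  obtain ⟨T, hT⟩ := hA.unitary
  have key : ∑ a : G, ‖orbitRadon π₁ h₂ A f (π₂ (a⁻¹ • x))‖ ^ 2
      = ∑ a : G, ‖f (π₁ (a⁻¹ • x))‖ ^ 2 := by
    rw [sum_norm_sq_orbit h₂, sum_norm_sq_orbit h₁,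
      orbitRestrict_orbitRadon h₁ h₂ hA.left_invariant T hT, LinearIsometryEquiv.norm_map, T.card_eq]
  have hconv : ∀ F : G → ℂ, ∑ a, ‖F a‖ₑ ^ 2 = ENNReal.ofReal (∑ a, ‖F a‖ ^ 2) := by
    intro F
    rw [ENNReal.ofReal_sum_of_nonneg fun a _ => sq_nonneg _]
    refine Finset.sum_congr rfl fun a _ => ?_
    rw [ENNReal.ofReal_pow (norm_nonneg _), ofReal_norm]
  rw [hconv, hconv, key]

section MeasureTheory

variable [MeasurableSpace X] [MeasurableSpace X₁] [MeasurableSpace X₂]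
  {μ : Measure X} {μ₁ : Measure X₁} {μ₂ : Measure X₂}

/-- Altering `f` on a null set `S` alters its Radon transform only on the image of the
`G`-invariant null set of all points with an orbit that meets the preimage of `S`. -/
lemma orbitRadon_congr_ae (h₂ : IsOrbitMap H₂ π₂)
    (hG : ∀ a : G, MeasurePreserving (fun x : X => a • x) μ μ)
    (hπ₁ : MeasurePreserving π₁ μ μ₁) (hπ₂ : MeasurePreserving π₂ μ μ₂)
    (hq₂ : ∀ s : Set X₂, MeasurableSet (π₂ ⁻¹' s) → MeasurableSet s)
    (hA : ∀ (b₂ : H₂) (a : G), A (b₂ * a) = A a)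
    {f f' : X₁ → ℂ} (hff' : f =ᵐ[μ₁] f') :
    orbitRadon π₁ h₂ A f =ᵐ[μ₂] orbitRadon π₁ h₂ A f' := by
  set S := toMeasurable μ₁ {y | f y ≠ f' y} with hS
  have hSnull : μ₁ S = 0 := by rw [hS, measure_toMeasurable]; exact hff'
  have hSmeas : MeasurableSet S := measurableSet_toMeasurable _ _
  let E : Set X := ⋃ a : G, (fun x => π₁ (a • x)) ⁻¹' S
  have hEmeas : MeasurableSet E :=
    MeasurableSet.iUnion fun a => (hπ₁.measurable.comp (hG a).measurable) hSmeas
  have hEnull : μ E = 0 := by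
    refine measure_iUnion_null fun a => ?_
    exact ((hπ₁.comp (hG a)).measure_preimage hSmeas.nullMeasurableSet).trans hSnull
  have hEinv : π₂ ⁻¹' (π₂ '' E) = E := by
    refine subset_antisymm ?_ (subset_preimage_image _ _)
    rintro x ⟨x', hx', hxx'⟩
    obtain ⟨a, ha⟩ := mem_iUnion.1 hx'
    obtain ⟨k, rfl⟩ := (h₂.eq_iff x x').1 hxx'.symm
    refine mem_iUnion.2 ⟨a * k, ?_⟩
    change π₁ ((a * (k : G)) • x) ∈ S
    rw [mul_smul]
    exact ha
  have himage : μ₂ (π₂ '' E) = 0 := by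
    rw [← hπ₂.measure_preimage (hq₂ _ (hEinv.symm ▸ hEmeas)).nullMeasurableSet, hEinv, hEnull]
  refine measure_mono_null (fun y hy => ?_) himage
  obtain ⟨x, rfl⟩ := h₂.surjective y
  refine ⟨x, ?_, rfl⟩
  by_contra hx
  refine hy ?_
  change orbitRadon π₁ h₂ A f (π₂ x) = orbitRadon π₁ h₂ A f' (π₂ x)
  rw [orbitRadon_apply h₂ hA, orbitRadon_apply h₂ hA]
  refine Finset.sum_congr rfl fun a _ => ?_
  congr 1
  by_contra hne
  exact hx (mem_iUnion.2 ⟨a⁻¹, subset_toMeasurable _ _ hne⟩)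

lemma aestronglyMeasurable_orbitRadon (h₂ : IsOrbitMap H₂ π₂)
    (hG : ∀ a : G, MeasurePreserving (fun x : X => a • x) μ μ)
    (hπ₁ : MeasurePreserving π₁ μ μ₁) (hπ₂ : MeasurePreserving π₂ μ μ₂)
    (hq₂ : ∀ s : Set X₂, MeasurableSet (π₂ ⁻¹' s) → MeasurableSet s)
    (hA : ∀ (b₂ : H₂) (a : G), A (b₂ * a) = A a)
    {f : X₁ → ℂ} (hf : AEStronglyMeasurable f μ₁) :
    AEStronglyMeasurable (orbitRadon π₁ h₂ A f) μ₂ := by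
  refine AEStronglyMeasurable.congr ?_
    (orbitRadon_congr_ae h₂ hG hπ₁ hπ₂ hq₂ hA hf.ae_eq_mk).symm
  refine (Measurable.stronglyMeasurable fun s hs => hq₂ _ ?_).aestronglyMeasurable
  have h : Measurable fun x => orbitRadon π₁ h₂ A (hf.mk f) (π₂ x) := by
    simp only [orbitRadon_apply h₂ hA]
    exact Finset.measurable_sum _ fun a _ => ((hf.stronglyMeasurable_mk.measurable.comp
      (hπ₁.measurable.comp (hG a⁻¹).measurable)).const_mul (A a))
  exact h hs

/-- The squared norm on a quotient of `X` is an average over `G` of integrals over `X`. -/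
lemma card_mul_eLpNorm_sq {p : X → X₁}
    (hG : ∀ a : G, MeasurePreserving (fun x : X => a • x) μ μ)
    (hp : MeasurePreserving p μ μ₁) {f : X₁ → ℂ} (hf : AEStronglyMeasurable f μ₁) :
    Fintype.card G * eLpNorm f 2 μ₁ ^ 2 = ∫⁻ x, ∑ a : G, ‖f (p (a⁻¹ • x))‖ₑ ^ 2 ∂μ := by
  have hm : ∀ a : G, AEStronglyMeasurable (fun x => f (p (a⁻¹ • x))) μ := fun a =>
    hf.comp_measurePreserving (hp.comp (hG a⁻¹))
  rw [lintegral_finsetSum' _ fun a _ => (hm a).enorm.pow_const 2]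
  have hint : ∀ a : G, ∫⁻ x, ‖f (p (a⁻¹ • x))‖ₑ ^ 2 ∂μ = eLpNorm f 2 μ₁ ^ 2 := by
    intro a
    rw [← eLpNorm_comp_measurePreserving hf (hp.comp (hG a⁻¹))]
    have := eLpNorm_nnreal_pow_eq_lintegral (μ := μ) (p := 2)
      (f := f ∘ (p ∘ fun x => a⁻¹ • x)) (by simp)
    simp only [NNReal.coe_ofNat, ENNReal.coe_ofNat, ENNReal.rpow_ofNat] at this
    exact this.symm
  rw [Finset.sum_congr rfl fun a _ => hint a]
  simp

lemma eLpNorm_orbitRadon (h₁ : IsOrbitMap H₁ π₁) (h₂ : IsOrbitMap H₂ π₂)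
    (hG : ∀ a : G, MeasurePreserving (fun x : X => a • x) μ μ)
    (hπ₁ : MeasurePreserving π₁ μ μ₁) (hπ₂ : MeasurePreserving π₂ μ μ₂)
    (hq₂ : ∀ s : Set X₂, MeasurableSet (π₂ ⁻¹' s) → MeasurableSet s)
    (hA : IsUnitaryIntertwiningKernel H₁ H₂ A)
    {f : X₁ → ℂ} (hf : AEStronglyMeasurable f μ₁) :
    eLpNorm (orbitRadon π₁ h₂ A f) 2 μ₂ = eLpNorm f 2 μ₁ := by
  have hU := aestronglyMeasurable_orbitRadon h₂ hG hπ₁ hπ₂ hq₂ hA.left_invariant hf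
  have h := card_mul_eLpNorm_sq hG hπ₂ hU
  simp only [sum_enorm_orbitRadon h₁ h₂ hA] at h
  rw [← card_mul_eLpNorm_sq hG hπ₁ hf,
    ENNReal.mul_right_inj (by simp) (ENNReal.natCast_ne_top _)] at h
  exact (ENNReal.pow_right_strictMono two_ne_zero).injective h

/-- The Radon transform as an isometry of `L²` spaces. -/
lemma exists_linearIsometry_orbitRadon (h₁ : IsOrbitMap H₁ π₁) (h₂ : IsOrbitMap H₂ π₂)
    (hG : ∀ a : G, MeasurePreserving (fun x : X => a • x) μ μ)
    (hπ₁ : MeasurePreserving π₁ μ μ₁) (hπ₂ : MeasurePreserving π₂ μ μ₂)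
    (hq₂ : ∀ s : Set X₂, MeasurableSet (π₂ ⁻¹' s) → MeasurableSet s)
    (hA : IsUnitaryIntertwiningKernel H₁ H₂ A) :
    ∃ L : Lp ℂ 2 μ₁ →ₗᵢ[ℂ] Lp ℂ 2 μ₂, ∀ (f : X₁ → ℂ) (hf : MemLp f 2 μ₁),
      L (hf.toLp f) =ᵐ[μ₂] orbitRadon π₁ h₂ A f := by
  have hnorm : ∀ {f : X₁ → ℂ}, AEStronglyMeasurable f μ₁ →
      eLpNorm (orbitRadon π₁ h₂ A f) 2 μ₂ = eLpNorm f 2 μ₁ :=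
    eLpNorm_orbitRadon h₁ h₂ hG hπ₁ hπ₂ hq₂ hA
  have hcongr : ∀ {f f' : X₁ → ℂ}, f =ᵐ[μ₁] f' →
      orbitRadon π₁ h₂ A f =ᵐ[μ₂] orbitRadon π₁ h₂ A f' :=
    orbitRadon_congr_ae h₂ hG hπ₁ hπ₂ hq₂ hA.left_invariant
  have hmem : ∀ {f : X₁ → ℂ}, MemLp f 2 μ₁ → MemLp (orbitRadon π₁ h₂ A f) 2 μ₂ := fun hf =>
    ⟨aestronglyMeasurable_orbitRadon h₂ hG hπ₁ hπ₂ hq₂ hA.left_invariant hf.1,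
      (hnorm hf.1).trans_lt hf.2⟩
  refine ⟨⟨⟨⟨fun φ => (hmem (Lp.memLp φ)).toLp _, fun φ ψ => ?_⟩, fun c φ => ?_⟩, fun φ => ?_⟩,
    fun f hf => ?_⟩
  · rw [← MemLp.toLp_add]
    refine MemLp.toLp_congr _ _ ((hcongr (Lp.coeFn_add φ ψ)).trans (.of_eq ?_))
    funext y
    simp only [orbitRadon, Pi.add_apply, mul_add, Finset.sum_add_distrib]
  · rw [RingHom.id_apply, ← MemLp.toLp_const_smul]
    refine MemLp.toLp_congr (hmem (Lp.memLp (c • φ))) _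
      ((hcongr (Lp.coeFn_smul c φ)).trans (.of_eq ?_))
    funext y
    simp only [orbitRadon, Pi.smul_apply, smul_eq_mul, Finset.mul_sum, mul_left_comm]
  · change ‖(hmem (Lp.memLp φ)).toLp _‖ = _
    rw [Lp.norm_toLp, hnorm (Lp.memLp φ).1, Lp.norm_def]
  · exact (hmem (Lp.memLp (hf.toLp f))).coeFn_toLp.trans (hcongr hf.coeFn_toLp)

lemma exists_unitary_orbitRadon (h₁ : IsOrbitMap H₁ π₁) (h₂ : IsOrbitMap H₂ π₂)
    (hG : ∀ a : G, MeasurePreserving (fun x : X => a • x) μ μ)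
    (hπ₁ : MeasurePreserving π₁ μ μ₁) (hπ₂ : MeasurePreserving π₂ μ μ₂)
    (hq₁ : ∀ s : Set X₁, MeasurableSet (π₁ ⁻¹' s) → MeasurableSet s)
    (hq₂ : ∀ s : Set X₂, MeasurableSet (π₂ ⁻¹' s) → MeasurableSet s)
    (hA : IsUnitaryIntertwiningKernel H₁ H₂ A) :
    ∃ U : Lp ℂ 2 μ₁ ≃ₗᵢ[ℂ] Lp ℂ 2 μ₂,
      (∀ (f : X₁ → ℂ) (hf : MemLp f 2 μ₁), U (hf.toLp f) =ᵐ[μ₂] orbitRadon π₁ h₂ A f) ∧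
      ∀ (f : X₂ → ℂ) (hf : MemLp f 2 μ₂),
        U.symm (hf.toLp f) =ᵐ[μ₁] orbitRadon π₂ h₁ (adjointKernel A) f := by
  obtain ⟨L, hL⟩ := exists_linearIsometry_orbitRadon h₁ h₂ hG hπ₁ hπ₂ hq₂ hA
  obtain ⟨L', hL'⟩ := exists_linearIsometry_orbitRadon h₂ h₁ hG hπ₂ hπ₁ hq₁ hA.adjoint
  have hLφ : ∀ φ : Lp ℂ 2 μ₁, L φ =ᵐ[μ₂] orbitRadon π₁ h₂ A φ := fun φ => by
    have := hL φ (Lp.memLp φ)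
    rwa [Lp.toLp_coeFn] at this
  have hL'φ : ∀ φ : Lp ℂ 2 μ₂, L' φ =ᵐ[μ₁] orbitRadon π₂ h₁ (adjointKernel A) φ := fun φ => by
    have := hL' φ (Lp.memLp φ)
    rwa [Lp.toLp_coeFn] at this
  have hLL' : ∀ φ, L (L' φ) = φ := by
    intro φ
    refine Lp.ext ((hLφ _).trans ((orbitRadon_congr_ae h₂ hG hπ₁ hπ₂ hq₂ hA.left_invariant
      (hL'φ φ)).trans (.of_eq ?_)))
    have := orbitRadon_adjointKernel_orbitRadon h₂ h₁ hA.adjoint φ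
    rwa [adjointKernel_adjointKernel] at this
  let U : Lp ℂ 2 μ₁ ≃ₗᵢ[ℂ] Lp ℂ 2 μ₂ :=
    LinearIsometryEquiv.ofSurjective L fun φ => ⟨L' φ, hLL' φ⟩
  refine ⟨U, hL, fun f hf => ?_⟩
  have hsymm : U.symm (hf.toLp f) = L' (hf.toLp f) :=
    (U.symm_apply_eq).2 (hLL' (hf.toLp f)).symm
  rw [hsymm]
  exact hL' f hf

end MeasureTheory

end OrbitRadon

/-! ### The lifted group actions -/

section LiftedAction

variable {n : ℕ} {G : Type*} [Group G]
  {M N : Type*} [TopologicalSpace M] [ChartedSpace (EuclideanSpace ℝ (Fin n)) M]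
  [IsManifold (𝓡 n) ∞ M] [TopologicalSpace N] [ChartedSpace (EuclideanSpace ℝ (Fin n)) N]
  [IsManifold (𝓡 n) ∞ N] [MulAction G M] {g : SmoothMetric n M} {g' : SmoothMetric n N}
  {p : M → N}

lemma cotangentLift_comp_of_isLocalDiffeomorph {N' : Type*} [TopologicalSpace N']
    [ChartedSpace (EuclideanSpace ℝ (Fin n)) N'] [IsManifold (𝓡 n) ∞ N'] {f : N → N'} {h : M → N}
    (hf : IsLocalDiffeomorph (𝓡 n) (𝓡 n) ∞ f) (hh : IsLocalDiffeomorph (𝓡 n) (𝓡 n) ∞ h)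
    (ζ : CotangentBundle n M) :
    cotangentLift (f ∘ h) ζ = cotangentLift f (cotangentLift h ζ) :=
  cotangentLift_comp (hf.mdifferentiable (by simp) _) (hh.mdifferentiable (by simp) _)
    ⟨(hh ζ.proj).mfderivToContinuousLinearEquiv (by simp),
      (hh ζ.proj).mfderivToContinuousLinearEquiv_coe (by simp)⟩

/-- The action `a • (x, ξ) = (a x, (a⁻¹)^* ξ)` on `T^*M`. -/
@[reducible]
def cotangentAction (hG : ∀ a : G, IsRiemannianLocalIsometry g g (fun x : M => a • x)) :
    MulAction G (CotangentBundle n M) where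
  smul a ζ := cotangentLift (fun x : M => a • x) ζ
  one_smul ζ := (cotangentLift_congr (.of_forall fun x => one_smul G x)).trans (cotangentLift_id ζ)
  mul_smul a b ζ := (cotangentLift_congr (.of_forall fun x => mul_smul a b x)).trans
    (cotangentLift_comp_of_isLocalDiffeomorph (hG a).isLocalDiffeomorph
      (hG b).isLocalDiffeomorph ζ)

/-- The action of `G` on `S^*M`. -/
@[reducible]
def cosphereAction (hG : ∀ a : G, IsRiemannianLocalIsometry g g (fun x : M => a • x)) :
    MulAction G (CosphereBundle g) where
  smul a ζ := cosphereLift (hG a) ζ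
  one_smul ζ := Subtype.ext ((cotangentAction hG).one_smul ζ.1)
  mul_smul a b ζ := Subtype.ext ((cotangentAction hG).mul_smul a b ζ.1)

lemma cosphereAction_free (hG : ∀ a : G, IsRiemannianLocalIsometry g g (fun x : M => a • x))
    (hfree : ∀ (a : G) (x : M), a • x = x → a = 1) :
    letI := cosphereAction hG
    ∀ (a : G) (ζ : CosphereBundle g), a • ζ = ζ → a = 1 := fun a ζ h =>
  hfree a ζ.1.proj (congrArg (fun η : CosphereBundle g => η.1.proj) h)

lemma isOrbitMap_cotangentLift {H : Subgroup G}
    (hG : ∀ a : G, IsRiemannianLocalIsometry g g (fun x : M => a • x))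
    (hp : IsRiemannianQuotient H g g' p) :
    letI := cotangentAction hG
    IsOrbitMap H (cotangentLift p : CotangentBundle n M → CotangentBundle n N) := by
  let _ := cotangentAction hG
  have hd := hp.isLocalIsometry.isLocalDiffeomorph
  have hinv : ∀ (k : H) (ζ : CotangentBundle n M),
      cotangentLift p (k • ζ) = (cotangentLift p ζ : CotangentBundle n N) := by
    intro k ζ
    refine (cotangentLift_comp_of_isLocalDiffeomorph hd (hG k).isLocalDiffeomorph ζ).symm.trans ?_
    exact cotangentLift_congr (.of_forall fun x => ((hp.fibre_eq_orbit x _).2 ⟨k, rfl⟩).symm)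
  refine ⟨fun ζ => ?_, fun ζ ζ' => ⟨fun h => ?_, ?_⟩⟩
  · obtain ⟨x, hx⟩ := hp.surjective ζ.proj
    obtain ⟨η, hη, -⟩ := existsUnique_cotangentLift_eq hd x ζ hx.symm
    exact ⟨η, hη.2⟩
  · obtain ⟨k, hk⟩ := (hp.fibre_eq_orbit ζ.proj ζ'.proj).1 (congrArg TotalSpace.proj h)
    exact ⟨k, cotangentLift_injOn_fibre hd hk ((hinv k ζ).trans h)⟩
  · rintro ⟨k, rfl⟩
    exact (hinv k ζ).symm

lemma isOrbitMap_cosphereLift {H : Subgroup G}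
    (hG : ∀ a : G, IsRiemannianLocalIsometry g g (fun x : M => a • x))
    (hp : IsRiemannianQuotient H g g' p) :
    letI := cosphereAction hG
    IsOrbitMap H (cosphereLift hp.isLocalIsometry) := by
  let _ := cosphereAction hG
  let _ := cotangentAction hG
  have h := isOrbitMap_cotangentLift hG hp
  refine ⟨fun ζ => ?_, fun ζ ζ' => ?_⟩
  · obtain ⟨η, hη⟩ := h.surjective ζ.1
    refine ⟨⟨η, ?_⟩, Subtype.ext hη⟩
    rw [← conormSq_cotangentLift hp.isLocalIsometry, hη]
    exact ζ.2
  · rw [Subtype.ext_iff]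
    refine (h.eq_iff ζ.1 ζ'.1).trans (exists_congr fun k => ?_)
    rw [Subtype.ext_iff]
    rfl

/-- A deck transformation is itself a Riemannian covering, with trivial group. -/
lemma isRiemannianQuotient_smul [T2Space M] [CompactSpace M]
    (hG : ∀ a : G, IsRiemannianLocalIsometry g g (fun x : M => a • x)) (a : G) :
    IsRiemannianQuotient (⊥ : Subgroup G) g g (fun x : M => a • x) where
  isCoveringMap := isLocalHomeomorph_iff_isCoveringMap.1 (hG a).isLocalDiffeomorph.isLocalHomeomorph
  surjective := MulAction.surjective a
  isLocalIsometry := hG a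
  fibre_eq_orbit x y := by
    rw [smul_left_cancel_iff]
    constructor
    · rintro rfl
      exact ⟨1, one_smul _ x⟩
    · rintro ⟨⟨k, hk⟩, rfl⟩
      obtain rfl := Subgroup.mem_bot.1 hk
      exact (one_smul G x).symm

lemma measurePreserving_cosphereAction [T2Space M] [CompactSpace M]
    (hG : ∀ a : G, IsRiemannianLocalIsometry g g (fun x : M => a • x)) (a : G) :
    MeasurePreserving (cosphereLift (hG a)) (liouvilleMeasure g) (liouvilleMeasure g) :=
  measurePreserving_cosphereLift (K := (⊥ : Subgroup G)) (fun k => hG k)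
    (fun k _ _ => Subsingleton.elim k 1) (isRiemannianQuotient_smul hG a)

/-- A set is Borel if its preimage is, because there are local sections. -/
lemma measurableSet_of_preimage_cosphereLift [CompactSpace N]
    (hp : IsRiemannianLocalIsometry g g' p) (hsurj : Function.Surjective p)
    (s : Set (CosphereBundle g')) (hs : MeasurableSet (cosphereLift hp ⁻¹' s)) :
    MeasurableSet s := by
  choose σ hσ using hsurj
  choose P hP hx hpP hlift using fun y : N =>
    hp.isLocalDiffeomorph.exists_partialDiffeo (σ y)
  have hmem : ∀ y, y ∈ (P y).target := fun y => by
    have := (P y).map_source (hx y)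
    rwa [← hpP y (hx y), hσ] at this
  obtain ⟨t, ht⟩ := isCompact_univ.elim_finite_subcover (fun y => (P y).target)
    (fun y => (P y).open_target) (fun y _ => mem_iUnion.2 ⟨y, hmem y⟩)
  let W : N → Set (CosphereBundle g') := fun y => {ζ | ζ.1.proj ∈ (P y).target}
  have hW : ∀ y, IsOpen (W y) := fun y =>
    (P y).open_target.preimage (continuous_cotangentProj.comp continuous_subtype_val)
  have hcover : s = ⋃ y ∈ t, s ∩ W y := by
    rw [← inter_iUnion₂]
    refine (inter_eq_left.2 fun ζ _ => ?_).symm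
    obtain ⟨y, hy, hζ⟩ := mem_iUnion₂.1 (ht (mem_univ ζ.1.proj))
    exact mem_iUnion₂.2 ⟨y, hy, hζ⟩
  rw [hcover]
  refine t.measurableSet_biUnion fun y _ => ?_
  have hproj : ∀ ζ : W y, (cotangentLift (P y).symm ζ.1.1).proj ∈ (P y).source :=
    fun ζ => (P y).map_target ζ.2
  have hback : ∀ ζ : W y, cotangentLift p (cotangentLift (P y).symm ζ.1.1) = ζ.1.1 := by
    intro ζ
    rw [hlift y _ (hproj ζ)]
    exact cotangentLift_symm_cotangentLift (hP y) ζ.2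
  have hunit : ∀ ζ : W y, conormSq g (cotangentLift (P y).symm ζ.1.1) = 1 := fun ζ => by
    rw [← conormSq_cotangentLift hp, hback ζ]
    exact ζ.1.2
  let τ : W y → CosphereBundle g := fun ζ => ⟨cotangentLift (P y).symm ζ.1.1, hunit ζ⟩
  have hτ : Continuous τ := by
    refine Continuous.subtype_mk ?_ _
    exact (hP y).symm.contMDiffOn_cotangentLift.continuousOn.comp_continuous
      (continuous_subtype_val.comp continuous_subtype_val) fun ζ => ζ.2
  have := (hW y).measurableSet.subtype_image (hτ.measurable hs)
  convert this using 1
  ext ζ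
  have hmemτ : ∀ h : ζ ∈ W y, τ ⟨ζ, h⟩ ∈ cosphereLift hp ⁻¹' s ↔ ζ ∈ s := by
    intro h
    rw [mem_preimage]
    have : cosphereLift hp (τ ⟨ζ, h⟩) = ζ := Subtype.ext (hback ⟨ζ, h⟩)
    rw [this]
  constructor
  · rintro ⟨h1, h2⟩
    exact ⟨⟨ζ, h2⟩, (hmemτ h2).2 h1, rfl⟩
  · rintro ⟨⟨ζ, h2⟩, h1, rfl⟩
    exact ⟨(hmemτ h2).1 h1, h2⟩

/-- Smoothness descends along the lift of a surjective local diffeomorphism. -/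
lemma contMDiff_of_comp_cotangentLift (hp : IsLocalDiffeomorph (𝓡 n) (𝓡 n) ∞ p)
    (hsurj : Function.Surjective p) {F : CotangentBundle n N → ℂ}
    (hF : ContMDiff ((𝓡 n).prod 𝓘(ℝ, EuclideanSpace ℝ (Fin n) →L[ℝ] ℝ)) 𝓘(ℝ, ℂ) ∞
      fun ζ : CotangentBundle n M => F (cotangentLift p ζ)) :
    ContMDiff ((𝓡 n).prod 𝓘(ℝ, EuclideanSpace ℝ (Fin n) →L[ℝ] ℝ)) 𝓘(ℝ, ℂ) ∞ F := by
  intro ζ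
  obtain ⟨x, hx⟩ := hsurj ζ.proj
  obtain ⟨P, hP, hxP, hpP, hlift⟩ := hp.exists_partialDiffeo x
  have hζ : ζ.proj ∈ P.target := by
    rw [← hx, hpP hxP]
    exact P.map_source hxP
  have hU : TotalSpace.proj ⁻¹' P.target ∈ 𝓝 ζ :=
    continuous_cotangentProj.continuousAt.preimage_mem_nhds (P.open_target.mem_nhds hζ)
  have h := (hF _).comp ζ (hP.symm.contMDiffOn_cotangentLift.contMDiffAt hU)
  refine h.congr_of_eventuallyEq ?_
  filter_upwards [hU] with η hη
  have hη : η.proj ∈ P.target := hη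
  have hproj : (cotangentLift P.symm η).proj ∈ P.source := P.map_target hη
  rw [Function.comp, hlift _ hproj, cotangentLift_symm_cotangentLift hP hη]

end LiftedAction

/-! ### The Radon transform on cosphere bundles -/

section Transform

variable {n : ℕ} {G : Type*} [Group G] [Fintype G] {H₁ H₂ : Subgroup G}
  {M M₁ M₂ : Type*} [TopologicalSpace M] [ChartedSpace (EuclideanSpace ℝ (Fin n)) M]
  [IsManifold (𝓡 n) ∞ M] [TopologicalSpace M₁] [ChartedSpace (EuclideanSpace ℝ (Fin n)) M₁]
  [IsManifold (𝓡 n) ∞ M₁] [TopologicalSpace M₂] [ChartedSpace (EuclideanSpace ℝ (Fin n)) M₂]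
  [IsManifold (𝓡 n) ∞ M₂] [MulAction G M]
  {g : SmoothMetric n M} {g₁ : SmoothMetric n M₁} {g₂ : SmoothMetric n M₂}
  {pr₁ : M → M₁} {pr₂ : M → M₂} {A : G → ℂ}

lemma radonTransform_eq_orbitRadon
    (hG : ∀ a : G, IsRiemannianLocalIsometry g g (fun x : M => a • x))
    (hfree : ∀ (a : G) (x : M), a • x = x → a = 1)
    (hpr₁ : IsRiemannianQuotient H₁ g g₁ pr₁) (hpr₂ : IsRiemannianQuotient H₂ g g₂ pr₂)
    (hA : IsUnitaryIntertwiningKernel H₁ H₂ A) (f : CosphereBundle g₁ → ℂ) :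
    let _ := cosphereAction hG
    radonTransform H₁ hG hpr₁.isLocalIsometry hpr₂.isLocalIsometry A f =
      orbitRadon (cosphereLift hpr₁.isLocalIsometry) (isOrbitMap_cosphereLift hG hpr₂) A f := by
  intro _
  obtain ⟨T, -⟩ := hA.unitary
  funext ζ
  exact orbitRadon_eq_fibreSum (isOrbitMap_cosphereLift hG hpr₂) (cosphereAction_free hG hfree)
    T.card_eq hA.left_invariant f ζ

lemma radonTransformAdjoint_eq_radonTransform
    (hG : ∀ a : G, IsRiemannianLocalIsometry g g (fun x : M => a • x))
    (h₁ : IsRiemannianLocalIsometry g g₁ pr₁) (h₂ : IsRiemannianLocalIsometry g g₂ pr₂)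
    (hcard : Nat.card H₁ = Nat.card H₂) (f : CosphereBundle g₂ → ℂ) :
    radonTransformAdjoint H₁ hG h₁ h₂ A f = radonTransform H₂ hG h₂ h₁ (adjointKernel A) f := by
  funext ζ
  rw [radonTransformAdjoint, radonTransform, hcard, ← Equiv.sum_comp (Equiv.inv G)]
  simp only [Equiv.inv_apply, adjointKernel, inv_inv]

/-- The Radon transform intertwines the Koopman operators, because the Hamiltonian flows commute
with the coverings and with the deck transformations. -/
lemma orbitRadon_koopman [T2Space M] [CompactSpace M] [T2Space M₁] [T2Space M₂]
    (hG : ∀ a : G, IsRiemannianLocalIsometry g g (fun x : M => a • x))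
    (hpr₁ : IsRiemannianQuotient H₁ g g₁ pr₁) (hpr₂ : IsRiemannianQuotient H₂ g g₂ pr₂)
    (hA : IsUnitaryIntertwiningKernel H₁ H₂ A) (t : ℝ) (f : CosphereBundle g₁ → ℂ) :
    let _ := cosphereAction hG
    orbitRadon (cosphereLift hpr₁.isLocalIsometry) (isOrbitMap_cosphereLift hG hpr₂) A
        (koopman g₁ t f) =
      koopman g₂ t (orbitRadon (cosphereLift hpr₁.isLocalIsometry)
        (isOrbitMap_cosphereLift hG hpr₂) A f) := by
  intro _
  funext ζ
  obtain ⟨η, rfl⟩ := (isOrbitMap_cosphereLift hG hpr₂).surjective ζ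
  rw [koopman, koopman, Function.comp_apply,
    ← cosphereLift_hamiltonianFlow hpr₂.isCoveringMap hpr₂.isLocalIsometry,
    orbitRadon_apply _ hA.left_invariant, orbitRadon_apply _ hA.left_invariant]
  refine Finset.sum_congr rfl fun a _ => ?_
  have ha : a⁻¹ • hamiltonianFlow g t η = hamiltonianFlow g t (a⁻¹ • η) :=
    cosphereLift_hamiltonianFlow (isRiemannianQuotient_smul hG a⁻¹).isCoveringMap (hG a⁻¹) t η
  rw [Function.comp_apply, ha,
    cosphereLift_hamiltonianFlow hpr₁.isCoveringMap hpr₁.isLocalIsometry]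

/-- The transform of the restriction of a smooth `F` on `T^*M₁` is the restriction of the Radon
transform of `F` for the action of `G` on `T^*M`. -/
lemma isSmoothOnCosphere_orbitRadon
    (hG : ∀ a : G, IsRiemannianLocalIsometry g g (fun x : M => a • x))
    (hpr₁ : IsRiemannianQuotient H₁ g g₁ pr₁) (hpr₂ : IsRiemannianQuotient H₂ g g₂ pr₂)
    (hA : IsUnitaryIntertwiningKernel H₁ H₂ A) {f : CosphereBundle g₁ → ℂ}
    (hf : IsSmoothOnCosphere g₁ f) :
    let _ := cosphereAction hG
    IsSmoothOnCosphere g₂ (orbitRadon (cosphereLift hpr₁.isLocalIsometry)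
      (isOrbitMap_cosphereLift hG hpr₂) A f) := by
  intro _
  let _ := cotangentAction hG
  obtain ⟨F, hF, hfF⟩ := hf
  have h₂ : IsOrbitMap H₂ (cotangentLift pr₂ : CotangentBundle n M → CotangentBundle n M₂) :=
    isOrbitMap_cotangentLift hG hpr₂
  refine ⟨orbitRadon (cotangentLift pr₁) h₂ A F, ?_, fun ζ => ?_⟩
  · refine contMDiff_of_comp_cotangentLift hpr₂.isLocalIsometry.isLocalDiffeomorph
      hpr₂.surjective ?_
    simp only [orbitRadon_apply h₂ hA.left_invariant]
    refine ContMDiff.sum fun a _ => ?_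
    refine (ContinuousLinearMap.mul ℝ ℂ (A a)).contMDiff.comp ?_
    exact hF.comp ((contMDiff_cotangentLift hpr₁.isLocalIsometry.isLocalDiffeomorph).comp
      (contMDiff_cotangentLift (hG a⁻¹).isLocalDiffeomorph))
  · obtain ⟨η, rfl⟩ := (isOrbitMap_cosphereLift hG hpr₂).surjective ζ
    rw [orbitRadon_apply _ hA.left_invariant]
    refine Eq.trans ?_ (orbitRadon_apply h₂ hA.left_invariant F η.1).symm
    exact Finset.sum_congr rfl fun a _ => congrArg (A a * ·) (hfF _)

lemma exists_unitary_radonTransform [T2Space M] [CompactSpace M]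
    [CompactSpace M₁] [CompactSpace M₂]
    (hG : ∀ a : G, IsRiemannianLocalIsometry g g (fun x : M => a • x))
    (hfree : ∀ (a : G) (x : M), a • x = x → a = 1)
    (hpr₁ : IsRiemannianQuotient H₁ g g₁ pr₁) (hpr₂ : IsRiemannianQuotient H₂ g g₂ pr₂)
    (hA : IsUnitaryIntertwiningKernel H₁ H₂ A) :
    let _ := cosphereAction hG
    ∃ U : Lp ℂ 2 (liouvilleMeasure g₁) ≃ₗᵢ[ℂ] Lp ℂ 2 (liouvilleMeasure g₂),
      (∀ (f : CosphereBundle g₁ → ℂ) (hf : MemLp f 2 (liouvilleMeasure g₁)),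
        U (hf.toLp f) =ᵐ[liouvilleMeasure g₂] orbitRadon (cosphereLift hpr₁.isLocalIsometry)
          (isOrbitMap_cosphereLift hG hpr₂) A f) ∧
      ∀ (f : CosphereBundle g₂ → ℂ) (hf : MemLp f 2 (liouvilleMeasure g₂)),
        U.symm (hf.toLp f) =ᵐ[liouvilleMeasure g₁] orbitRadon (cosphereLift hpr₂.isLocalIsometry)
          (isOrbitMap_cosphereLift hG hpr₁) (adjointKernel A) f := by
  classical
  intro _
  exact exists_unitary_orbitRadon (isOrbitMap_cosphereLift hG hpr₁)
    (isOrbitMap_cosphereLift hG hpr₂) (measurePreserving_cosphereAction hG)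
    (measurePreserving_cosphereLift (K := H₁) (fun k => hG k)
      (fun k x hk => Subtype.ext (hfree k x hk)) hpr₁)
    (measurePreserving_cosphereLift (K := H₂) (fun k => hG k)
      (fun k x hk => Subtype.ext (hfree k x hk)) hpr₂)
    (measurableSet_of_preimage_cosphereLift hpr₁.isLocalIsometry hpr₁.surjective)
    (measurableSet_of_preimage_cosphereLift hpr₂.isLocalIsometry hpr₂.surjective) hA

end Transform

end

theorem theorem1p2 {n : ℕ} {G : Type*} [Group G] [Fintype G] (H₁ H₂ : Subgroup G)
    {M M₀ M₁ M₂ : Type*}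
    [TopologicalSpace M] [T2Space M] [CompactSpace M]
    [ChartedSpace (EuclideanSpace ℝ (Fin n)) M] [IsManifold (𝓡 n) ∞ M]
    [TopologicalSpace M₀] [T2Space M₀] [CompactSpace M₀]
    [ChartedSpace (EuclideanSpace ℝ (Fin n)) M₀] [IsManifold (𝓡 n) ∞ M₀]
    [TopologicalSpace M₁] [T2Space M₁] [CompactSpace M₁]
    [ChartedSpace (EuclideanSpace ℝ (Fin n)) M₁] [IsManifold (𝓡 n) ∞ M₁]
    [TopologicalSpace M₂] [T2Space M₂] [CompactSpace M₂]
    [ChartedSpace (EuclideanSpace ℝ (Fin n)) M₂] [IsManifold (𝓡 n) ∞ M₂]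
    [MulAction G M]
    (g : SmoothMetric n M) (g₀ : SmoothMetric n M₀)
    (g₁ : SmoothMetric n M₁) (g₂ : SmoothMetric n M₂)
    (pr : M → M₀) (pr₁ : M → M₁) (pr₂ : M → M₂) (p₁ : M₁ → M₀) (p₂ : M₂ → M₀)
    -- the diagram of Riemannian coverings
    (hG : ∀ a : G, IsRiemannianLocalIsometry g g (fun x : M => a • x))
    (hfree : ∀ (a : G) (x : M), a • x = x → a = 1)
    (hpr : IsRiemannianQuotient G g g₀ pr)
    (hpr₁ : IsRiemannianQuotient H₁ g g₁ pr₁)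
    (hpr₂ : IsRiemannianQuotient H₂ g g₂ pr₂)
    (hp₁ : IsRiemannianLocalIsometry g₁ g₀ p₁) (hp₂ : IsRiemannianLocalIsometry g₂ g₀ p₂)
    (hcomm₁ : p₁ ∘ pr₁ = pr) (hcomm₂ : p₂ ∘ pr₂ = pr)
    (hSunada : SunadaCondition H₁ H₂) :
    (∃ A : G → ℂ, IsUnitaryIntertwiningKernel H₁ H₂ A) ∧
    ∀ A : G → ℂ, IsUnitaryIntertwiningKernel H₁ H₂ A →
      -- the Radon transform is a unitary operator `U`, whose adjoint is given by the adjoint kernel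
      (∃ U : Lp ℂ 2 (liouvilleMeasure g₁) ≃ₗᵢ[ℂ] Lp ℂ 2 (liouvilleMeasure g₂),
        (∀ (f : CosphereBundle g₁ → ℂ) (hf : MemLp f 2 (liouvilleMeasure g₁)),
          U (hf.toLp f) =ᵐ[liouvilleMeasure g₂]
            radonTransform H₁ hG hpr₁.isLocalIsometry hpr₂.isLocalIsometry A f) ∧
        (∀ (f : CosphereBundle g₂ → ℂ) (hf : MemLp f 2 (liouvilleMeasure g₂)),
          U.symm (hf.toLp f) =ᵐ[liouvilleMeasure g₁]
            radonTransformAdjoint H₁ hG hpr₁.isLocalIsometry hpr₂.isLocalIsometry A f) ∧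
        -- it conjugates the Koopman operators on `L^2`
        (∀ (t : ℝ)
          (V₁ : Lp ℂ 2 (liouvilleMeasure g₁) →L[ℂ] Lp ℂ 2 (liouvilleMeasure g₁))
          (V₂ : Lp ℂ 2 (liouvilleMeasure g₂) →L[ℂ] Lp ℂ 2 (liouvilleMeasure g₂)),
          IsKoopmanL2 g₁ t V₁ → IsKoopmanL2 g₂ t V₂ →
            ∀ φ : Lp ℂ 2 (liouvilleMeasure g₂), U (V₁ (U.symm φ)) = V₂ φ)) ∧
      -- on functions, the transform and its adjoint are inverse to each other, preserve smoothness,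
      -- and conjugate the Koopman operators at every point
      (∀ f : CosphereBundle g₁ → ℂ,
        radonTransformAdjoint H₁ hG hpr₁.isLocalIsometry hpr₂.isLocalIsometry A
          (radonTransform H₁ hG hpr₁.isLocalIsometry hpr₂.isLocalIsometry A f) = f) ∧
      (∀ f : CosphereBundle g₂ → ℂ,
        radonTransform H₁ hG hpr₁.isLocalIsometry hpr₂.isLocalIsometry A
          (radonTransformAdjoint H₁ hG hpr₁.isLocalIsometry hpr₂.isLocalIsometry A f) = f) ∧
      (∀ f : CosphereBundle g₁ → ℂ, IsSmoothOnCosphere g₁ f →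
        IsSmoothOnCosphere g₂
          (radonTransform H₁ hG hpr₁.isLocalIsometry hpr₂.isLocalIsometry A f)) ∧
      (∀ f : CosphereBundle g₂ → ℂ, IsSmoothOnCosphere g₂ f →
        IsSmoothOnCosphere g₁
          (radonTransformAdjoint H₁ hG hpr₁.isLocalIsometry hpr₂.isLocalIsometry A f)) ∧
      (∀ (t : ℝ) (f : CosphereBundle g₂ → ℂ),
        radonTransform H₁ hG hpr₁.isLocalIsometry hpr₂.isLocalIsometry A
          (koopman g₁ t
            (radonTransformAdjoint H₁ hG hpr₁.isLocalIsometry hpr₂.isLocalIsometry A f))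
          = koopman g₂ t f) := by
  have hcard : Nat.card H₁ = Nat.card H₂ := hSunada.elim UnitaryModuleEquiv.card_eq
  refine ⟨hSunada.elim exists_isUnitaryIntertwiningKernel, fun A hA => ?_⟩
  let _ := cosphereAction hG
  have hR := radonTransform_eq_orbitRadon hG hfree hpr₁ hpr₂ hA
  have hR' : ∀ f, radonTransformAdjoint H₁ hG hpr₁.isLocalIsometry hpr₂.isLocalIsometry A f =
      orbitRadon (cosphereLift hpr₂.isLocalIsometry) (isOrbitMap_cosphereLift hG hpr₁)
        (adjointKernel A) f := fun f =>
    (radonTransformAdjoint_eq_radonTransform hG _ _ hcard f).trans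
      (radonTransform_eq_orbitRadon hG hfree hpr₂ hpr₁ hA.adjoint f)
  simp only [hR, hR']
  have hleft := orbitRadon_adjointKernel_orbitRadon (isOrbitMap_cosphereLift hG hpr₁)
    (isOrbitMap_cosphereLift hG hpr₂) hA
  have hright := orbitRadon_adjointKernel_orbitRadon (isOrbitMap_cosphereLift hG hpr₂)
    (isOrbitMap_cosphereLift hG hpr₁) hA.adjoint
  rw [adjointKernel_adjointKernel] at hright
  have hkoop := orbitRadon_koopman hG hpr₁ hpr₂ hA
  obtain ⟨U, hU, hU'⟩ := exists_unitary_radonTransform hG hfree hpr₁ hpr₂ hA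
  refine ⟨⟨U, hU, hU', fun t V₁ V₂ hV₁ hV₂ φ => Lp.ext ?_⟩, hleft, hright,
    fun f hf => isSmoothOnCosphere_orbitRadon hG hpr₁ hpr₂ hA hf,
    fun f hf => isSmoothOnCosphere_orbitRadon hG hpr₂ hpr₁ hA.adjoint hf,
    fun t f => ?_⟩
  · have hφ := Lp.memLp φ
    have h₁ := hU' φ hφ
    rw [Lp.toLp_coeFn] at h₁
    have hm₁ := (memLp_congr_ae h₁).1 (Lp.memLp _)
    have h₂ := hV₁ _ hm₁
    rw [← MemLp.toLp_congr (Lp.memLp _) hm₁ h₁, Lp.toLp_coeFn] at h₂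
    have hm₂ := (memLp_congr_ae h₂).1 (Lp.memLp _)
    have h₃ := hU _ hm₂
    rw [← MemLp.toLp_congr (Lp.memLp _) hm₂ h₂, Lp.toLp_coeFn, hkoop, hright] at h₃
    have h₄ := hV₂ φ hφ
    rw [Lp.toLp_coeFn] at h₄
    exact h₃.trans h₄.symm
  · rw [hkoop, hright]
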